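/- Let $N\ge 1$. For a lower triangular matrix $H=[h_{i,j}]\in\mathbb R^{(N-1)\times(N-1)}$ and an operator $T$ on a real Hilbert space $\mathcal X$, consider the fixed-step algorithm started at $y_0\in\mathcal X$, $$y_{k+1}=y_k-\sum_{j=0}^{k}h_{k+1,j+1}\,(y_j-Ty_j),\qquad k=0,\dots,N-2 .$$ Let $\mathcal H_\star(N-1)$ be the set of *optimal* $H$, i.e. lower triangular $H$ such that $\|y_{N-1}-Ty_{N-1}\|^2\le \frac{4\|y_0-y_\star\|^2}{N^2}$ for every real Hilbert space $\mathcal X$, every nonexpansive $T\colon\mathcal X\to\mathcal X$, every fixed point $y_\star$ of $T$ and every $y_0\in\mathcal X$. The H-dual $H^{\mathsf A}$ of $H$ is its anti-diagonal transpose, with $(k,j)$ entry $h_{N-j,N-k}$. For $1\le m,j\le N-1$ let $$Q(m,j;H)=\sum_{j=j(1)\le i(1)<j(2)\le i(2)<\cdots<j(m)\le i(m)\le N-1}\ \prod_{r=1}^m h_{i(r),j(r)},$$ and define the H-certificates $$\lambda^\star_{N,j}(H)=N\sum_{m=1}^{N-1}(-1)^{m-1}Q(m,j;H)\quad(1\le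 j\le N-1),$$ $$\lambda^\star_{k,j}(H)=N\sum_{\ell=1}^{N-1}\sum_{m=1}^{N-1}(-1)^{\ell+m-1}\binom{\ell+m}{m}Q(\ell,j;H)\,Q(m,k;H)\quad(1\le j<k\le N-1).$$ A *vertex* of $\mathcal H_\star(N-1)$ (an optimal vertex algorithm) is an $H\in\mathcal H_\star(N-1)$ for which the number of pairs $1\le j<k\le N$ with $\lambda^\star_{k,j}(H)=0$ is maximal among all elements of $\mathcal H_\star(N-1)$. **Theorem.** Let $H$ be a vertex of $\mathcal H_\star(N-1)$. For each $j\in\{1,\dots,N-1\}$ there is exactly one $k(j)\in\{j+1,\dots,N\}$ with $\lambda^\star_{k(j),j}(H)\neq 0$, and $\lambda^\star_{k(j),j}(H)>0$; let $\mathcal G(H)$ be the arc diagram on the nodes $\{1,\dots,N\}$ with arcs $(k(j),j)$, $1\le j\le N-1$. Call $\mathcal G(H)$ non-crossing if there are no $j_1,j_2\in\{1,\dots,N-1\}$ with $j_1<j_2<k(j_1)<k(j_2)$. For a node $j$ let $\mathcal C(j)=\{j,k(j),k(k(j)),\dots,N\}$ be the increasing path from $j$ to $N$, and for a node $v$ let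 $\ell(v)=\min\{j: v\in\mathcal C(j)\}$. Then 1. $H^{\mathsf A}\in\mathcal H_\star(N-1)$ if and only if $\mathcal G(H)$ is non-crossing; 2. if $\mathcal G(H)$ is non-crossing, then $H^{\mathsf A}$ is again a vertex of $\mathcal H_\star(N-1)$ and, for all $1\le j<i\le N$, $$\lambda^\star_{N-j+1,\,N-i+1}(H^{\mathsf A})=\begin{cases}\dfrac{1}{\lambda^\star_{k(i-1),\,i-1}(H)} & \text{if } j=\ell(i-1),\\[2mm] 0&\text{otherwise.}\end{cases}$$ -/

import Mathlib

open scoped Matrix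

namespace FixedPointH

/-! Throughout, `N = n + 1`, an H-matrix is a matrix `H` of size `N - 1 = n`, and its rows and
columns, the nodes of diagrams and the indices of certificates are numbered from `1`. -/

/-- The entry `h_{i,j}` for `1 ≤ i, j ≤ N - 1` (and `0` for other indices). -/
def entry {n : ℕ} (H : Matrix (Fin n) (Fin n) ℝ) (i j : ℕ) : ℝ :=
  if h : (1 ≤ i ∧ i ≤ n) ∧ (1 ≤ j ∧ j ≤ n) then H ⟨i - 1, by omega⟩ ⟨j - 1, by omega⟩ else 0

/-- `y_0, …, y_{N-1}` are the iterates of the fixed-step algorithm with H-matrix `H` applied to `T`: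
`y_{k+1} = y_k - ∑_{j=0}^{k} h_{k+1,j+1} (y_j - T y_j)` for `k = 0, …, N - 2`. -/
def IsIterates {n : ℕ} (H : Matrix (Fin n) (Fin n) ℝ) {X : Type} [AddCommGroup X] [Module ℝ X]
    (T : X → X) (y : ℕ → X) : Prop :=
  ∀ k < n, y (k + 1) = y k - ∑ j ∈ Finset.range (k + 1), entry H (k + 1) (j + 1) • (y j - T (y j))

/-- Membership in `ℋ⋆(N - 1)`: `H` is lower triangular and its algorithm satisfies
`‖y_{N-1} - T y_{N-1}‖² ≤ 4 ‖y_0 - y⋆‖² / N²` for every nonexpansive operator `T` on a real Hilbert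
space, every fixed point `y⋆` of `T` and every starting point `y_0`. -/
def IsOptimal {n : ℕ} (H : Matrix (Fin n) (Fin n) ℝ) : Prop :=
  H.IsLowerTriangular ∧
    ∀ (X : Type) [NormedAddCommGroup X] [InnerProductSpace ℝ X] [CompleteSpace X]
      (T : X → X) (yStar : X) (y : ℕ → X),
      (∀ u v : X, ‖T u - T v‖ ≤ ‖u - v‖) → T yStar = yStar → IsIterates H T y →
        ‖y n - T (y n)‖ ^ 2 ≤ 4 * ‖y 0 - yStar‖ ^ 2 / ((n : ℝ) + 1) ^ 2

/-- The H-dual `H^A` (anti-diagonal transpose): its `(k, j)` entry is `h_{N-j,N-k}`. -/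
def hDual {n : ℕ} (H : Matrix (Fin n) (Fin n) ℝ) : Matrix (Fin n) (Fin n) ℝ :=
  Matrix.of fun k j => H j.rev k.rev

/-- The Q-function `Q(m, j; H)` for `m ≥ 1`: the sum of the products `∏_{r=1}^m h_{i(r),j(r)}` over
all `j = j(1) ≤ i(1) < j(2) ≤ i(2) < ⋯ < j(m) ≤ i(m) ≤ N - 1`, summed successively over
`i(1)`, `j(2)`, `i(2)`, …. -/
def Q {n : ℕ} (H : Matrix (Fin n) (Fin n) ℝ) : ℕ → ℕ → ℝ
  | 0, _ => 0
  | 1, j => ∑ i ∈ Finset.Icc j n, entry H i j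
  | m + 2, j => ∑ i ∈ Finset.Icc j n, entry H i j * ∑ j' ∈ Finset.Icc (i + 1) n, Q H (m + 1) j'

/-- The H-certificates `λ⋆_{k,j}(H)`, `1 ≤ j < k ≤ N`. -/
noncomputable def cert {n : ℕ} (H : Matrix (Fin n) (Fin n) ℝ) (k j : ℕ) : ℝ :=
  if k = n + 1 then
    ((n : ℝ) + 1) * ∑ m ∈ Finset.Icc 1 n, (-1 : ℝ) ^ (m - 1) * Q H m j
  else
    ((n : ℝ) + 1) * ∑ l ∈ Finset.Icc 1 n, ∑ m ∈ Finset.Icc 1 n,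
      (-1 : ℝ) ^ (l + m - 1) * ((l + m).choose m : ℝ) * Q H l j * Q H m k

/-- The index pairs `(k, j)`, `1 ≤ j < k ≤ N`, whose H-certificate vanishes at `H`. -/
def zeroCerts {n : ℕ} (H : Matrix (Fin n) (Fin n) ℝ) : Set (ℕ × ℕ) :=
  {p | 1 ≤ p.2 ∧ p.2 < p.1 ∧ p.1 ≤ n + 1 ∧ cert H p.1 p.2 = 0}

/-- `H` is a vertex of `ℋ⋆(N - 1)`, i.e. an optimal vertex algorithm: it is optimal and lies on a
maximal number of the zero sets of the H-certificates, among all optimal H-matrices. -/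
def IsVertex {n : ℕ} (H : Matrix (Fin n) (Fin n) ℝ) : Prop :=
  IsOptimal H ∧
    ∀ H' : Matrix (Fin n) (Fin n) ℝ, IsOptimal H' → (zeroCerts H').ncard ≤ (zeroCerts H).ncard

/-- `𝒢(H)` is the arc diagram on `{1, …, N}` with arcs `(k(j), j)`, `j = 1, …, N - 1`: for each `j`,
the index `k(j)` is the only `l ∈ {j + 1, …, N}` with `λ⋆_{l,j}(H) ≠ 0`, and
`λ⋆_{k(j),j}(H) > 0`. Only the values `k(1), …, k(N-1)` matter. -/
def IsArcDiagramOf {n : ℕ} (k : ℕ → ℕ) (H : Matrix (Fin n) (Fin n) ℝ) : Prop :=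
  ∀ j, 1 ≤ j → j ≤ n →
    j < k j ∧ k j ≤ n + 1 ∧ 0 < cert H (k j) j ∧
      ∀ l, j < l → l ≤ n + 1 → l ≠ k j → cert H l j = 0

/-- An arc diagram on `{1, …, n + 1}` is non-crossing: there are no `j₁ < j₂` in `{1, …, n}` with
`j₁ < j₂ < k(j₁) < k(j₂)`. -/
def NonCrossing (n : ℕ) (k : ℕ → ℕ) : Prop :=
  ¬ ∃ j₁ j₂, 1 ≤ j₁ ∧ j₂ ≤ n ∧ j₁ < j₂ ∧ j₂ < k j₁ ∧ k j₁ < k j₂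

/-- The set `𝒞(j)` of nodes on the increasing path `j, k(j), k(k(j)), …, N` of an arc diagram on
`{1, …, N}`, `N = n + 1`; the path stops at `N`. -/
def path (n : ℕ) (k : ℕ → ℕ) (j : ℕ) : Set ℕ :=
  {v | Relation.ReflTransGen (fun u w => 1 ≤ u ∧ u ≤ n ∧ w = k u) j v}

/-- The smallest descendant `ℓ(v) = min {j : v ∈ 𝒞(j)}` of a node `v ∈ {1, …, N}`. -/
noncomputable def leastDescendant (n : ℕ) (k : ℕ → ℕ) (v : ℕ) : ℕ :=
  sInf {j | 1 ≤ j ∧ j ≤ n + 1 ∧ v ∈ path n k j}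

end FixedPointH

open FixedPointH

/-!
Let `C` be the strictly lower triangular matrix with `y k = y 0 - ∑ l, C k l • (y l - T (y l))`.
The Q-functions are the entries of the last rows of the powers of `C` (`Q_eq_powRow`), and by
Pascal's rule the matrix `M` with entries `- λ⋆` off the diagonal is the unique solution of the
Lyapunov equation `M C + Cᵀ M + M = (n + 1) e eᵀ`, where `e` is the last unit vector
(`isLyapunov_certMatrix`, `IsLyapunov.unique`).

`H` is optimal if and only if `M` is a grounded Laplacian, i.e. `M 1 = e` and `M` is nonpositive off
the diagonal. If it is, then `gap_identity` writes the gap in the optimal bound as a square plus a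
nonnegative combination of nonexpansiveness inequalities (`IsCertificate.isOptimal`). Conversely
(`IsOptimal.isCertificate`), let the algorithm run on the isometry `twist`, a cyclic shift with
`twist ^ (n + 1) = -1`. The equality case of the Cauchy–Schwarz inequality determines the row sums
of the powers of `C`, which gives `M 1 = e`. The optimal bound is then attained, with linearly
independent iterates, so that bending the isometry slightly with the gradient of a convex function
tests the sign of any single entry of `M` (`IsOptimal.sum_bend_nonneg`).

In such an `M` every node other than the last has an arc to a later node
(`IsOptimal.exists_ne_zero`), and the Halpern algorithm has exactly one per node. So the vertices
are the optimal `H` for which `M` is the Laplacian of a tree whose arcs lead to later nodes.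

The Lyapunov equation of `M` is equivalent to `C X + X Cᵀ + X = (n + 1) 1 1ᵀ` for the inverse
`X = M⁻¹`. Moreover, the matrix of reversed partial sums of `M` solves the latter equation for the
H-dual (`IsLyapunov.isDualLyapunov_hDual`): it is the inverse of the matrix that certifies `H^A`, if
there is one. For a tree, the entry of this matrix at two gaps between consecutive nodes is `1` plus
the total weight of the arcs covering both. If no arcs cross, the sets of gaps covered by the arcs
form a laminar family, and the inverse is the Laplacian of the tree of this family, with inverse
weights (`IsArcDiagramOf.isCertificate_hDual`). If `H^A` is optimal, then `M⁻¹` is a matrix of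
partial sums of a grounded Laplacian, so it decreases along its rows to the right of the diagonal,
and this fails when two arcs cross (`IsArcDiagramOf.nonCrossing`).
-/

open scoped Matrix

namespace FixedPointH

/-! ### The matrix of accumulated step sizes -/

/-- The matrix `C` of accumulated step sizes `C k l = ∑_{l ≤ i < k} h_{i+1,l+1}`, with rows and
columns numbered from `0`. The iterates satisfy `y k = y 0 - ∑ l, C k l • (y l - T (y l))`. -/
def stepSum {n : ℕ} (H : Matrix (Fin n) (Fin n) ℝ) : Matrix (Fin (n + 1)) (Fin (n + 1)) ℝ :=
  Matrix.of fun k l => ∑ a : Fin n,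
    if (l : ℕ) ≤ a ∧ (a : ℕ) < k then entry H (a + 1) (l + 1) else 0

/-- All entries on and above the diagonal vanish. -/
def StrictLower {n : ℕ} (C : Matrix (Fin (n + 1)) (Fin (n + 1)) ℝ) : Prop :=
  ∀ k l, k ≤ l → C k l = 0

lemma strictLower_stepSum {n : ℕ} (H : Matrix (Fin n) (Fin n) ℝ) : StrictLower (stepSum H) := by
  intro k l hkl
  have : (k : ℕ) ≤ l := hkl
  simp only [stepSum, Matrix.of_apply]
  exact Finset.sum_eq_zero fun a _ => if_neg (by omega)

/-- The last row of the `m`-th power of `C`. -/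
def powRow {n : ℕ} (C : Matrix (Fin (n + 1)) (Fin (n + 1)) ℝ) (m : ℕ) (j : Fin (n + 1)) : ℝ :=
  (C ^ m) (Fin.last n) j

section powRow

variable {n : ℕ} {C : Matrix (Fin (n + 1)) (Fin (n + 1)) ℝ}

lemma powRow_zero (j : Fin (n + 1)) : powRow C 0 j = if j = Fin.last n then 1 else 0 := by
  simp [powRow, Matrix.one_apply, eq_comm]

lemma powRow_succ (m : ℕ) (j : Fin (n + 1)) :
    powRow C (m + 1) j = ∑ k, powRow C m k * C k j := by
  simp [powRow, pow_succ, Matrix.mul_apply]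

lemma powRow_eq_zero (hC : StrictLower C) (m : ℕ) (j : Fin (n + 1)) (h : n < j + m) :
    powRow C m j = 0 := by
  induction m generalizing j with
  | zero => omega
  | succ m ih =>
    rw [powRow_succ]
    refine Finset.sum_eq_zero fun k _ => ?_
    by_cases hk : k ≤ j
    · rw [hC k j hk, mul_zero]
    · have : (j : ℕ) < k := not_le.mp hk
      rw [ih k (by omega), zero_mul]

end powRow

lemma sum_Icc_eq_sum_fin {n : ℕ} (f : ℕ → ℝ) (j : ℕ) :
    ∑ i ∈ Finset.Icc (j + 1) n, f i = ∑ a : Fin n, if j ≤ (a : ℕ) then f (a + 1) else 0 := by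
  rw [Fin.sum_univ_eq_sum_range (fun a => if j ≤ a then f (a + 1) else 0) n, ← Finset.sum_filter]
  refine Finset.sum_nbij' (fun i => i - 1) (fun a => a + 1) ?_ ?_ ?_ ?_ ?_
  · intro i hi; simp only [Finset.mem_Icc, Finset.mem_filter, Finset.mem_range] at *; omega
  · intro i hi; simp only [Finset.mem_Icc, Finset.mem_filter, Finset.mem_range] at *; omega
  · intro i hi; simp only [Finset.mem_Icc] at hi; omega
  · intro i hi; simp
  · intro i hi
    simp only [Finset.mem_Icc] at hi
    congr 1; omega

/-- The Q-functions are the last rows of the powers of the matrix of accumulated step sizes: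
expanding a matrix power as a sum over index chains gives the defining sum. -/
lemma Q_eq_powRow {n : ℕ} (H : Matrix (Fin n) (Fin n) ℝ) (m : ℕ) (j : Fin (n + 1)) :
    Q H (m + 1) (j + 1) = powRow (stepSum H) (m + 1) j := by
  induction m generalizing j with
  | zero =>
    rw [powRow_succ]
    simp only [powRow_zero, ite_mul, one_mul, zero_mul, Finset.sum_ite_eq', Finset.mem_univ,
      if_true]
    rw [Q, sum_Icc_eq_sum_fin]
    refine Finset.sum_congr rfl fun a _ => ?_
    simp
  | succ m ih =>
    have key : ∀ a : Fin n, ∑ j' ∈ Finset.Icc ((a : ℕ) + 1 + 1) n, Q H (m + 1) j' =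
        ∑ k : Fin (n + 1), if (a : ℕ) < k then powRow (stepSum H) (m + 1) k else 0 := by
      intro a
      rw [sum_Icc_eq_sum_fin, Fin.sum_univ_castSucc (n := n)]
      rw [powRow_eq_zero (strictLower_stepSum H) (m + 1) (Fin.last n) (by simp), ite_self, add_zero]
      refine Finset.sum_congr rfl fun b _ => ?_
      rw [← ih]
      simp
    rw [powRow_succ, Q, sum_Icc_eq_sum_fin]
    simp only [key]
    generalize powRow (stepSum H) (m + 1) = p
    simp only [stepSum, Matrix.of_apply, Finset.mul_sum]
    rw [Finset.sum_comm]
    refine Finset.sum_congr rfl fun a _ => ?_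
    split_ifs with h
    · refine Finset.sum_congr rfl fun k _ => ?_
      by_cases hk : (a : ℕ) < k
      · simp [h, hk, mul_comm]
      · simp [hk]
    · simp [h]

/-! ### The certificate matrix and its Lyapunov equation -/

/-- The certificate matrix: a symmetric matrix whose entries below the diagonal are the negatives
of the H-certificates. It depends on `H` only through `C = stepSum H`. -/
def certMatrix {n : ℕ} (C : Matrix (Fin (n + 1)) (Fin (n + 1)) ℝ) :
    Matrix (Fin (n + 1)) (Fin (n + 1)) ℝ :=
  Matrix.of fun a b => ((n : ℝ) + 1) * ∑ l ∈ Finset.range (n + 1), ∑ m ∈ Finset.range (n + 1),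
    (-1 : ℝ) ^ (l + m) * ((l + m).choose m : ℝ) * powRow C l a * powRow C m b

/-- The equation `M C + Cᵀ M + M = (n + 1) e eᵀ`, where `e` is the last unit vector. -/
def IsLyapunov {n : ℕ} (C M : Matrix (Fin (n + 1)) (Fin (n + 1)) ℝ) : Prop :=
  ∀ a b, (M * C) a b + (Cᵀ * M) a b + M a b =
    if a = Fin.last n ∧ b = Fin.last n then (n : ℝ) + 1 else 0

lemma certMatrix_symm {n : ℕ} (C : Matrix (Fin (n + 1)) (Fin (n + 1)) ℝ) (a b : Fin (n + 1)) :
    certMatrix C a b = certMatrix C b a := by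
  simp only [certMatrix, Matrix.of_apply]
  rw [Finset.sum_comm]
  congr 1
  refine Finset.sum_congr rfl fun l _ => Finset.sum_congr rfl fun m _ => ?_
  rw [add_comm m l, Nat.choose_symm_add]
  ring

/-- The coefficients `(-1)^(l+m) * choose (l+m) m` satisfy the Pascal recursion that makes the
Lyapunov equation telescope. -/
lemma sum_pascal (n : ℕ) (x z : ℕ → ℝ) (hx : x (n + 1) = 0) (hz : z (n + 1) = 0) :
    ∑ l ∈ Finset.range (n + 1), ∑ m ∈ Finset.range (n + 1),
      (-1 : ℝ) ^ (l + m) * ((l + m).choose m : ℝ) *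
        (x l * z (m + 1) + x (l + 1) * z m + x l * z m) = x 0 * z 0 := by
  set μ : ℕ → ℕ → ℝ := fun l m => (-1 : ℝ) ^ (l + m) * ((l + m).choose m : ℝ) with hμ
  have h1 : ∀ l, ∑ m ∈ Finset.range (n + 1), μ l m * (x l * z (m + 1)) =
      ∑ m ∈ Finset.range n, μ l m * (x l * z (m + 1)) := by
    intro l; rw [Finset.sum_range_succ, hz]; ring
  have h2 : ∑ l ∈ Finset.range (n + 1), ∑ m ∈ Finset.range (n + 1), μ l m * (x (l + 1) * z m) =
      ∑ l ∈ Finset.range n, ∑ m ∈ Finset.range (n + 1), μ l m * (x (l + 1) * z m) := by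
    rw [Finset.sum_range_succ, hx]; simp
  have hp : ∀ l m, μ (l + 1) (m + 1) = - μ (l + 1) m - μ l (m + 1) := by
    intro l m
    simp only [hμ]
    rw [show l + 1 + (m + 1) = (l + m + 1) + 1 by ring, Nat.choose_succ_succ,
      show l + 1 + m = l + m + 1 by ring, show l + (m + 1) = l + m + 1 by ring]
    push_cast; ring
  have h0 : ∀ l, μ (l + 1) 0 = - μ l 0 := by intro l; simp [hμ, pow_succ]
  have h0' : ∀ m, μ 0 (m + 1) = - μ 0 m := by intro l; simp [hμ, pow_succ]
  have h00 : μ 0 0 = 1 := by simp [hμ]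
  calc _ = ∑ l ∈ Finset.range (n + 1), ∑ m ∈ Finset.range (n + 1), μ l m * (x l * z (m + 1)) +
        ∑ l ∈ Finset.range (n + 1), ∑ m ∈ Finset.range (n + 1), μ l m * (x (l + 1) * z m) +
        ∑ l ∈ Finset.range (n + 1), ∑ m ∈ Finset.range (n + 1), μ l m * (x l * z m) := by
        simp only [← Finset.sum_add_distrib, mul_add, hμ]
    _ = _ := by
        simp only [h1]
        rw [h2, Finset.sum_range_succ' (fun l => ∑ m ∈ Finset.range n, μ l m * (x l * z (m + 1))),
          Finset.sum_range_succ' (fun l => ∑ m ∈ Finset.range (n + 1), μ l m * (x l * z m))]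
        simp only [Finset.sum_range_succ' _ n]
        simp only [hp, h0, h0', h00]
        simp only [Finset.sum_add_distrib, sub_mul, neg_mul, Finset.sum_sub_distrib,
          Finset.sum_neg_distrib]
        ring

lemma isLyapunov_certMatrix {n : ℕ} {C : Matrix (Fin (n + 1)) (Fin (n + 1)) ℝ}
    (hC : StrictLower C) : IsLyapunov C (certMatrix C) := by
  intro a b
  have h := sum_pascal n (fun l => powRow C l a) (fun m => powRow C m b)
    (powRow_eq_zero hC _ _ (by omega)) (powRow_eq_zero hC _ _ (by omega))
  have e1 : (certMatrix C * C) a b = ((n : ℝ) + 1) * ∑ l ∈ Finset.range (n + 1),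
      ∑ m ∈ Finset.range (n + 1), (-1 : ℝ) ^ (l + m) * ((l + m).choose m : ℝ) *
        (powRow C l a * powRow C (m + 1) b) := by
    simp only [Matrix.mul_apply, certMatrix, Matrix.of_apply, mul_assoc, ← Finset.mul_sum,
      Finset.sum_mul, powRow_succ]
    congr 1
    rw [Finset.sum_comm]
    refine Finset.sum_congr rfl fun l _ => ?_
    rw [Finset.sum_comm]
    refine Finset.sum_congr rfl fun m _ => ?_
    simp only [← Finset.mul_sum]
  have e2 : (Cᵀ * certMatrix C) a b = ((n : ℝ) + 1) * ∑ l ∈ Finset.range (n + 1),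
      ∑ m ∈ Finset.range (n + 1), (-1 : ℝ) ^ (l + m) * ((l + m).choose m : ℝ) *
        (powRow C (l + 1) a * powRow C m b) := by
    simp only [Matrix.mul_apply, Matrix.transpose_apply, certMatrix, Matrix.of_apply, powRow_succ,
      Finset.mul_sum, Finset.sum_mul]
    rw [Finset.sum_comm]
    refine Finset.sum_congr rfl fun l _ => ?_
    rw [Finset.sum_comm]
    refine Finset.sum_congr rfl fun m _ => Finset.sum_congr rfl fun k _ => ?_
    ring
  rw [e1, e2]
  simp only [certMatrix, Matrix.of_apply]
  rw [← mul_add, ← mul_add, ← Finset.sum_add_distrib, ← Finset.sum_add_distrib]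
  simp only [← Finset.sum_add_distrib]
  rw [show (if a = Fin.last n ∧ b = Fin.last n then (n : ℝ) + 1 else 0) =
    ((n : ℝ) + 1) * (powRow C 0 a * powRow C 0 b) by
      simp only [powRow_zero]; split_ifs <;> simp_all]
  rw [← h]
  congr 1
  refine Finset.sum_congr rfl fun l _ => Finset.sum_congr rfl fun m _ => ?_
  ring

/-- Since `C` is strictly lower triangular, the equation determines the entry `M a b` from the
entries `M a' b'` with `a' + b' > a + b`. -/
lemma IsLyapunov.unique {n : ℕ} {C M M' : Matrix (Fin (n + 1)) (Fin (n + 1)) ℝ}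
    (hC : StrictLower C) (h : IsLyapunov C M) (h' : IsLyapunov C M') : M = M' := by
  have key : ∀ d : ℕ, ∀ a b : Fin (n + 1), 2 * n ≤ d + a + b → M a b = M' a b := by
    intro d
    induction d with
    | zero =>
      intro a b hab
      have ha : a = Fin.last n := Fin.ext (by simp; omega)
      have hb : b = Fin.last n := Fin.ext (by simp; omega)
      have e := h a b
      have e' := h' a b
      simp only [Matrix.mul_apply, Matrix.transpose_apply] at e e'
      have z : ∀ k, C k (Fin.last n) = 0 := fun k => hC _ _ (Fin.le_last k)
      simp only [ha, hb, z, mul_zero, zero_mul, Finset.sum_const_zero, zero_add] at e e' ⊢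
      rw [e, e']
    | succ d ih =>
      intro a b hab
      have e := h a b
      have e' := h' a b
      have e1 : (M * C) a b = (M' * C) a b := by
        simp only [Matrix.mul_apply]
        refine Finset.sum_congr rfl fun k _ => ?_
        by_cases hk : k ≤ b
        · rw [hC k b hk]; simp
        · have : (b : ℕ) < k := not_le.mp hk
          rw [ih a k (by omega)]
      have e2 : (Cᵀ * M) a b = (Cᵀ * M') a b := by
        simp only [Matrix.mul_apply, Matrix.transpose_apply]
        refine Finset.sum_congr rfl fun k _ => ?_
        by_cases hk : k ≤ a
        · rw [hC k a hk]; simp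
        · have : (a : ℕ) < k := not_le.mp hk
          rw [ih k b (by omega)]
      rw [e1, e2] at e
      linarith
  ext a b
  exact key (2 * n) a b (by omega)

lemma cert_eq_neg_certMatrix {n : ℕ} (H : Matrix (Fin n) (Fin n) ℝ) {a b : Fin (n + 1)}
    (hab : b < a) : cert H (a + 1) (b + 1) = - certMatrix (stepSum H) a b := by
  have hab' : (b : ℕ) < a := hab
  have hb : powRow (stepSum H) 0 b = 0 := by
    rw [powRow_zero, if_neg]; rintro rfl; simp at hab'; omega
  have shift : ∀ f : ℕ → ℝ, ∑ m ∈ Finset.Icc 1 n, f m = ∑ m ∈ Finset.range n, f (m + 1) := by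
    intro f
    rw [Finset.range_eq_Ico, Finset.sum_Ico_add' f 0 n 1, zero_add]
    rfl
  rw [certMatrix_symm]
  simp only [certMatrix, Matrix.of_apply]
  rw [Finset.sum_range_succ' (fun l => ∑ m ∈ Finset.range (n + 1), (-1 : ℝ) ^ (l + m) *
    ((l + m).choose m : ℝ) * powRow (stepSum H) l b * powRow (stepSum H) m a)]
  simp only [hb, mul_zero, zero_mul, Finset.sum_const_zero, add_zero]
  by_cases ha : a = Fin.last n
  · subst ha
    rw [cert, if_pos (by simp), shift, ← mul_neg, ← Finset.sum_neg_distrib]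
    congr 1
    refine Finset.sum_congr rfl fun m _ => ?_
    rw [Finset.sum_range_succ', Finset.sum_eq_zero]
    · rw [powRow_zero, Q_eq_powRow]; simp [pow_succ]
    · intro l _
      rw [powRow_eq_zero (strictLower_stepSum H) (l + 1) (Fin.last n) (by simp), mul_zero]
  · have ha' : (a : ℕ) ≠ n := fun h => ha (Fin.ext h)
    rw [cert, if_neg (by omega), shift, ← mul_neg, ← Finset.sum_neg_distrib]
    congr 1
    refine Finset.sum_congr rfl fun m _ => ?_
    rw [Finset.sum_range_succ', powRow_zero, if_neg ha, shift, mul_zero, add_zero,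
      ← Finset.sum_neg_distrib]
    refine Finset.sum_congr rfl fun l _ => ?_
    rw [Q_eq_powRow, Q_eq_powRow, show m + 1 + (l + 1) - 1 = m + 1 + l by omega,
      show m + 1 + (l + 1) = (m + 1 + l) + 1 by ring, pow_succ]
    ring

/-! ### Certified algorithms are optimal -/

/-- `M` certifies that the algorithm with accumulated step sizes `C` is optimal. Besides the
Lyapunov equation, `M` is the Laplacian of a graph on `Fin (n + 1)` with nonnegative weights
`- M a b`, grounded at the last node with weight `1`. -/
structure IsCertificate {n : ℕ} (C M : Matrix (Fin (n + 1)) (Fin (n + 1)) ℝ) : Prop where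
  lyapunov : IsLyapunov C M
  symm : ∀ a b, M a b = M b a
  rowSum : ∀ a, ∑ b, M a b = if a = Fin.last n then 1 else 0
  nonpos : ∀ a b, a ≠ b → M a b ≤ 0

lemma stepSum_succ {n : ℕ} (H : Matrix (Fin n) (Fin n) ℝ) (a : Fin n) (l : Fin (n + 1)) :
    stepSum H a.succ l =
      stepSum H a.castSucc l + if (l : ℕ) ≤ a then entry H (a + 1) (l + 1) else 0 := by
  simp only [stepSum, Matrix.of_apply]
  have e : (if (l : ℕ) ≤ a then entry H (a + 1) (l + 1) else 0) = ∑ x : Fin n,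
      if x = a then (if (l : ℕ) ≤ x then entry H (x + 1) (l + 1) else 0) else 0 := by simp
  rw [e, ← Finset.sum_add_distrib]
  refine Finset.sum_congr rfl fun x _ => ?_
  by_cases hx : x = a
  · subst hx; simp
  · have : (x : ℕ) ≠ a := fun h => hx (Fin.ext h)
    simp only [hx, if_false, add_zero, Fin.val_succ, Fin.val_castSucc]
    congr 1
    simp only [eq_iff_iff]
    omega

lemma IsIterates.eq_sub_sum {n : ℕ} {H : Matrix (Fin n) (Fin n) ℝ} {X : Type} [AddCommGroup X]
    [Module ℝ X] {T : X → X} {y : ℕ → X} (hy : IsIterates H T y) (k : Fin (n + 1)) :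
    y k = y 0 - ∑ l : Fin (n + 1), stepSum H k l • (y l - T (y l)) := by
  induction k using Fin.induction with
  | zero => simp [strictLower_stepSum H 0 _ (Fin.zero_le _)]
  | succ a ih =>
    have h := hy a a.2
    simp only [stepSum_succ, add_smul, Finset.sum_add_distrib]
    rw [Fin.val_succ, h, ← sub_sub, ← ih, Fin.val_castSucc]
    congr 1
    simp only [ite_smul, zero_smul]
    rw [Fin.sum_univ_eq_sum_range (fun l => if l ≤ (a : ℕ) then
      entry H (a + 1) (l + 1) • (y l - T (y l)) else 0) (n + 1), ← Finset.sum_filter]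
    refine Finset.sum_congr ?_ fun _ _ => rfl
    ext x
    simp only [Finset.mem_range, Finset.mem_filter]
    omega

section identity

variable {n : ℕ} {C M : Matrix (Fin (n + 1)) (Fin (n + 1)) ℝ} {E : Type*} [NormedAddCommGroup E]
  [InnerProductSpace ℝ E] {u v : Fin (n + 1) → E}

/-- The gap in the optimal bound, for iterates `u` with images `v` measured from a fixed point,
as a square plus a combination of the nonexpansiveness inequalities with coefficients from `M`. -/
lemma gap_identity (hL : IsLyapunov C M) (hs : ∀ a b, M a b = M b a)
    (hr : ∀ a, ∑ b, M a b = if a = Fin.last n then 1 else 0)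
    (hu : ∀ k, u k = u 0 - ∑ l, C k l • (u l - v l)) :
    4 * ‖u 0‖ ^ 2 / ((n : ℝ) + 1) ^ 2 - ‖u (Fin.last n) - v (Fin.last n)‖ ^ 2 =
      ‖(2 / ((n : ℝ) + 1)) • u 0 - (u (Fin.last n) - v (Fin.last n))‖ ^ 2 +
        2 / ((n : ℝ) + 1) * ∑ k, ∑ j, M k j * (inner ℝ (u k) (u j) - inner ℝ (v k) (v j)) := by
  obtain ⟨g, hg⟩ : ∃ g : Fin (n + 1) → E, ∀ k, g k = u k - v k := ⟨_, fun _ => rfl⟩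
  have hv : ∀ k, v k = u k - g k := fun k => by rw [hg]; abel
  simp only [← hg] at hu ⊢
  have h1 : ∀ k j, inner ℝ (u k) (u j) - inner ℝ (v k) (v j) =
      inner ℝ (g k) (u j) + inner ℝ (g j) (u k) - inner ℝ (g k) (g j) := by
    intro k j
    rw [hv, hv]
    simp only [inner_sub_left, inner_sub_right]
    rw [real_inner_comm (u k) (g j)]
    ring
  have h2 : ∀ k j, inner ℝ (g k) (u j) =
      inner ℝ (g k) (u 0) - ∑ l, C j l * inner ℝ (g k) (g l) := by
    intro k j
    conv_lhs => rw [hu j]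
    simp only [inner_sub_right, inner_sum, inner_smul_right]
  have h3 : ∑ k, ∑ j, M k j * inner ℝ (g k) (u j) =
      inner ℝ (g (Fin.last n)) (u 0) - ∑ k, ∑ l, (M * C) k l * inner ℝ (g k) (g l) := by
    have e : ∀ k, ∑ j, M k j * inner ℝ (g k) (u j) =
        (if k = Fin.last n then 1 else 0) * inner ℝ (g k) (u 0) -
          ∑ l, (M * C) k l * inner ℝ (g k) (g l) := by
      intro k
      rw [← hr, Finset.sum_mul]
      simp only [Matrix.mul_apply, Finset.sum_mul]
      rw [Finset.sum_comm (f := fun l j => M k j * C j l * inner ℝ (g k) (g l)),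
        ← Finset.sum_sub_distrib]
      refine Finset.sum_congr rfl fun j _ => ?_
      rw [h2, mul_sub, Finset.mul_sum]
      simp only [mul_assoc]
    simp only [e, Finset.sum_sub_distrib, ite_mul, one_mul, zero_mul, Finset.sum_ite_eq',
      Finset.mem_univ, if_true]
  have h4 : ∑ k, ∑ j, M k j * inner ℝ (g j) (u k) =
      inner ℝ (g (Fin.last n)) (u 0) - ∑ k, ∑ l, (Cᵀ * M) k l * inner ℝ (g k) (g l) := by
    rw [Finset.sum_comm]
    simp only [hs]
    rw [h3]
    congr 1
    rw [Finset.sum_comm]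
    refine Finset.sum_congr rfl fun k _ => Finset.sum_congr rfl fun l _ => ?_
    rw [real_inner_comm (g k) (g l)]
    congr 1
    simp only [Matrix.mul_apply, Matrix.transpose_apply]
    refine Finset.sum_congr rfl fun j _ => ?_
    rw [mul_comm, hs]
  have h5 : ∑ k, ∑ j, M k j * (inner ℝ (u k) (u j) - inner ℝ (v k) (v j)) =
      2 * inner ℝ (g (Fin.last n)) (u 0) - ((n : ℝ) + 1) * ‖g (Fin.last n)‖ ^ 2 := by
    have e : ∑ k, ∑ l, ((M * C) k l + (Cᵀ * M) k l + M k l) * inner ℝ (g k) (g l) =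
        ((n : ℝ) + 1) * ‖g (Fin.last n)‖ ^ 2 := by
      simp only [hL _ _, ite_and, ite_mul, zero_mul]
      rw [Finset.sum_eq_single (Fin.last n)]
      · simp
      · intro b _ hb; simp [hb]
      · simp
    simp only [h1, mul_sub, mul_add, Finset.sum_add_distrib, Finset.sum_sub_distrib, h3, h4]
    rw [← e]
    simp only [add_mul, Finset.sum_add_distrib]
    ring
  rw [h5, norm_sub_sq_real, inner_smul_left, norm_smul, real_inner_comm (g (Fin.last n)) (u 0)]
  have hN : ((n : ℝ) + 1) ≠ 0 := by positivity
  rw [mul_pow, Real.norm_eq_abs, sq_abs]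
  simp only [conj_trivial]
  rw [real_inner_comm]
  field_simp
  ring

/-- Summing a grounded Laplacian against Gram-type data gives a weighted sum over its edges. -/
lemma laplacian_sum (hs : ∀ a b, M a b = M b a)
    (hr : ∀ a, ∑ b, M a b = if a = Fin.last n then 1 else 0) (B : Fin (n + 1) → Fin (n + 1) → ℝ) :
    ∑ k, ∑ j, M k j * B k j = B (Fin.last n) (Fin.last n) +
      ∑ k, ∑ j, (- M k j / 2) * (B k k - 2 * B k j + B j j) := by
  have e1 : ∑ k, ∑ j, M k j * B k k = B (Fin.last n) (Fin.last n) := by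
    simp only [← Finset.sum_mul, hr, ite_mul, one_mul, zero_mul, Finset.sum_ite_eq',
      Finset.mem_univ, if_true]
  have e2 : ∑ k, ∑ j, M k j * B j j = B (Fin.last n) (Fin.last n) := by
    rw [Finset.sum_comm]
    simp only [hs]
    exact e1
  have e3 : ∀ k j, (- M k j / 2) * (B k k - 2 * B k j + B j j) =
      M k j * B k j - (1 / 2) * (M k j * B k k) - (1 / 2) * (M k j * B j j) := by
    intro k j; ring
  simp only [e3, Finset.sum_sub_distrib, ← Finset.mul_sum, e1, e2]
  ring

end identity

theorem IsCertificate.isOptimal {n : ℕ} {H : Matrix (Fin n) (Fin n) ℝ}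
    {M : Matrix (Fin (n + 1)) (Fin (n + 1)) ℝ} (hM : IsCertificate (stepSum H) M)
    (hH : H.IsLowerTriangular) : IsOptimal H := by
  refine ⟨hH, fun X _ _ _ T z y hT hz hy => ?_⟩
  have h := gap_identity (u := fun k : Fin (n + 1) => y k - z)
    (v := fun k : Fin (n + 1) => T (y k) - z) hM.lyapunov hM.symm hM.rowSum (by
      intro k
      simp only [sub_sub_sub_cancel_right, Fin.val_zero]
      rw [hy.eq_sub_sum k]
      abel)
  rw [laplacian_sum hM.symm hM.rowSum] at h
  simp only [sub_sub_sub_cancel_right, Fin.val_zero, Fin.val_last] at h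
  have hexp : ∀ a b : X, 0 ≤ ‖a - b‖ ^ 2 - ‖T a - T b‖ ^ 2 := fun a b =>
    sub_nonneg.mpr (pow_le_pow_left₀ (norm_nonneg _) (hT a b) 2)
  have hlast : 0 ≤ inner ℝ (y n - z) (y n - z) - inner ℝ (T (y n) - z) (T (y n) - z) := by
    have := hexp (y n) z
    rwa [hz, ← real_inner_self_eq_norm_sq, ← real_inner_self_eq_norm_sq] at this
  have hsum : 0 ≤ ∑ k : Fin (n + 1), ∑ j : Fin (n + 1), (- M k j / 2) *
      ((inner ℝ (y k - z) (y k - z) - inner ℝ (T (y k) - z) (T (y k) - z)) -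
        2 * (inner ℝ (y k - z) (y j - z) - inner ℝ (T (y k) - z) (T (y j) - z)) +
        (inner ℝ (y j - z) (y j - z) - inner ℝ (T (y j) - z) (T (y j) - z))) := by
    refine Finset.sum_nonneg fun k _ => Finset.sum_nonneg fun j _ => ?_
    rcases eq_or_ne k j with rfl | hkj
    · refine le_of_eq ?_; ring
    · refine mul_nonneg (by have := hM.nonpos k j hkj; linarith) ?_
      have := hexp (y k) (y j)
      rw [← sub_sub_sub_cancel_right (y k) (y j) z,
        ← sub_sub_sub_cancel_right (T (y k)) (T (y j)) z, norm_sub_sq_real (y k - z),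
        norm_sub_sq_real (T (y k) - z)] at this
      simp only [real_inner_self_eq_norm_sq]
      linarith
  have : 0 ≤ 2 / ((n : ℝ) + 1) := by positivity
  have h2 := mul_nonneg this (add_nonneg hlast hsum)
  have h3 := sq_nonneg ‖(2 / ((n : ℝ) + 1)) • (y 0 - z) - (y n - T (y n))‖
  linarith

/-! ### The twisted cyclic shift and the invariants of optimal algorithms -/

lemma exists_isIterates {n : ℕ} (H : Matrix (Fin n) (Fin n) ℝ) {X : Type} [AddCommGroup X]
    [Module ℝ X] (T : X → X) (x : X) : ∃ y : ℕ → X, y 0 = x ∧ IsIterates H T y := by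
  have key : ∀ K : ℕ, ∃ y : ℕ → X, y 0 = x ∧ ∀ k < K, y (k + 1) =
      y k - ∑ j ∈ Finset.range (k + 1), entry H (k + 1) (j + 1) • (y j - T (y j)) := by
    intro K
    induction K with
    | zero => exact ⟨fun _ => x, rfl, fun k hk => absurd hk (Nat.not_lt_zero k)⟩
    | succ K ih =>
      obtain ⟨y, h0, hy⟩ := ih
      refine ⟨Function.update y (K + 1) (y K - ∑ j ∈ Finset.range (K + 1),
        entry H (K + 1) (j + 1) • (y j - T (y j))), ?_, fun k hk => ?_⟩
      · rw [Function.update_of_ne (by omega), h0]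
      · have hs : ∀ j ∈ Finset.range (k + 1), j ≠ K + 1 := by
          intro j hj; rw [Finset.mem_range] at hj; omega
        have hsum : ∀ w, ∑ j ∈ Finset.range (k + 1), entry H (k + 1) (j + 1) •
            (Function.update y (K + 1) w j - T (Function.update y (K + 1) w j)) =
            ∑ j ∈ Finset.range (k + 1), entry H (k + 1) (j + 1) • (y j - T (y j)) := fun w =>
          Finset.sum_congr rfl fun j hj => by rw [Function.update_of_ne (hs j hj)]
        rw [Function.update_of_ne (a := k) (by omega), hsum]
        rcases Nat.lt_succ_iff_lt_or_eq.mp hk with h | rfl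
        · rw [Function.update_of_ne (by omega), hy k h]
        · rw [Function.update_self]
  exact key n

/-- The twisted cyclic shift of `ℝ^(n+1)`: the isometry sending each unit vector to the next one
and the last one to the negative of the first. -/
noncomputable def twist (n : ℕ) :
    EuclideanSpace ℝ (Fin (n + 1)) →ₗ[ℝ] EuclideanSpace ℝ (Fin (n + 1)) where
  toFun x := WithLp.toLp 2 (Fin.cons (-x (Fin.last n)) fun i : Fin n => x i.castSucc)
  map_add' x y := by
    ext i
    refine Fin.cases ?_ (fun i => ?_) i
    · simp [add_comm]
    · simp
  map_smul' c x := by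
    ext i
    refine Fin.cases ?_ (fun i => ?_) i <;> simp

lemma twist_zero {n : ℕ} (x : EuclideanSpace ℝ (Fin (n + 1))) :
    twist n x 0 = -x (Fin.last n) := rfl

lemma twist_succ {n : ℕ} (x : EuclideanSpace ℝ (Fin (n + 1))) (i : Fin n) :
    twist n x i.succ = x i.castSucc := rfl

lemma norm_twist {n : ℕ} (x : EuclideanSpace ℝ (Fin (n + 1))) : ‖twist n x‖ = ‖x‖ := by
  rw [← sq_eq_sq₀ (norm_nonneg _) (norm_nonneg _), EuclideanSpace.real_norm_sq_eq,
    EuclideanSpace.real_norm_sq_eq, Fin.sum_univ_succ, Fin.sum_univ_castSucc (n := n)]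
  simp only [twist_zero, twist_succ]
  ring

lemma inner_twist {n : ℕ} (x y : EuclideanSpace ℝ (Fin (n + 1))) :
    inner ℝ (twist n x) (twist n y) = inner ℝ x y :=
  LinearIsometry.inner_map_map (⟨twist n, norm_twist⟩ : _ →ₗᵢ[ℝ] _) x y

lemma twist_pow_single {n : ℕ} (i : Fin (n + 1)) :
    (twist n ^ (i : ℕ)) (EuclideanSpace.single 0 1) = EuclideanSpace.single i 1 := by
  induction i using Fin.induction with
  | zero => simp
  | succ i ih =>
    rw [Fin.val_castSucc] at ih
    rw [Fin.val_succ, pow_succ', Module.End.mul_apply, ih]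
    ext j
    refine Fin.cases ?_ (fun j => ?_) j
    · rw [twist_zero]
      simp [Fin.ext_iff]
      have := i.2
      omega
    · rw [twist_succ]
      simp

lemma twist_single_last {n : ℕ} :
    twist n (EuclideanSpace.single (Fin.last n) 1) = -EuclideanSpace.single 0 1 := by
  ext j
  refine Fin.cases ?_ (fun j => ?_) j
  · rw [twist_zero]; simp
  · rw [twist_succ]
    simp [Fin.ext_iff, j.2.ne]

lemma twist_pow_card {n : ℕ} : twist n ^ (n + 1) = -1 := by
  have h0 : (twist n ^ (n + 1)) (EuclideanSpace.single 0 1) = -EuclideanSpace.single 0 1 := by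
    have := twist_pow_single (Fin.last n)
    rw [Fin.val_last] at this
    rw [pow_succ', Module.End.mul_apply, this, twist_single_last]
  refine (EuclideanSpace.basisFun (Fin (n + 1)) ℝ).toBasis.ext fun i => ?_
  simp only [OrthonormalBasis.coe_toBasis, EuclideanSpace.basisFun_apply]
  rw [← twist_pow_single i, ← Module.End.mul_apply, ← pow_add, add_comm (n + 1) (i : ℕ), pow_add,
    Module.End.mul_apply, h0, map_neg]
  rfl

/-- The last iterate of a linear operator `U` is a polynomial in `U - 1`, whose coefficients are
the row sums of the powers of the matrix of accumulated step sizes. -/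
lemma linear_last_iterate {n : ℕ} {C : Matrix (Fin (n + 1)) (Fin (n + 1)) ℝ} (hC : StrictLower C)
    {E : Type*} [AddCommGroup E] [Module ℝ E] (U : E →ₗ[ℝ] E) {y : Fin (n + 1) → E} {y0 : E}
    (hy : ∀ k, y k = y0 - ∑ l, C k l • (y l - U (y l))) :
    y (Fin.last n) =
      ∑ m ∈ Finset.range (n + 1), (∑ j, powRow C m j) • ((U - 1) ^ m) y0 := by
  have step : ∀ m, ∑ j, powRow C m j • y j =
      (∑ j, powRow C m j) • y0 + (U - 1) (∑ j, powRow C (m + 1) j • y j) := by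
    intro m
    have e : (U - 1) (∑ j, powRow C (m + 1) j • y j) =
        - ∑ j, powRow C m j • ∑ l, C j l • (y l - U (y l)) := by
      simp only [powRow_succ, map_sum, map_smul, Finset.sum_smul, Finset.smul_sum, smul_smul]
      rw [Finset.sum_comm, ← Finset.sum_neg_distrib]
      refine Finset.sum_congr rfl fun k _ => ?_
      rw [← Finset.sum_neg_distrib]
      refine Finset.sum_congr rfl fun j _ => ?_
      rw [LinearMap.sub_apply, Module.End.one_apply, ← smul_neg, neg_sub]
    rw [e, Finset.sum_smul, ← sub_eq_add_neg, ← Finset.sum_sub_distrib]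
    refine Finset.sum_congr rfl fun j _ => ?_
    rw [← smul_sub, ← hy]
  have iter : ∀ K, ∑ j, powRow C 0 j • y j =
      ∑ m ∈ Finset.range K, (∑ j, powRow C m j) • ((U - 1) ^ m) y0 +
        ((U - 1) ^ K) (∑ j, powRow C K j • y j) := by
    intro K
    induction K with
    | zero => simp
    | succ K ih =>
      rw [ih, step K, map_add, map_smul, Finset.sum_range_succ, pow_succ, Module.End.mul_apply,
        add_assoc]
  have h := iter (n + 1)
  have hz : ∀ j : Fin (n + 1), powRow C (n + 1) j = 0 := fun j => powRow_eq_zero hC _ _ (by omega)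
  simpa [hz, powRow_zero] using h

section polynomial

open Polynomial

/-- The polynomial `p` with `y n = p(U) (y 0)` for the iterates `y` of every linear operator `U`. -/
noncomputable def iteratePoly {n : ℕ} (C : Matrix (Fin (n + 1)) (Fin (n + 1)) ℝ) : ℝ[X] :=
  ∑ m ∈ Finset.range (n + 1), Polynomial.C (∑ j, powRow C m j) * (X - 1) ^ m

lemma natDegree_iteratePoly_lt {n : ℕ} (C : Matrix (Fin (n + 1)) (Fin (n + 1)) ℝ) :
    (iteratePoly C).natDegree < n + 1 := by
  refine Nat.lt_succ_of_le (natDegree_sum_le_of_forall_le _ _ fun m hm => ?_)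
  refine (natDegree_C_mul_le _ _).trans ((natDegree_pow_le).trans ?_)
  rw [← C_1, natDegree_X_sub_C, mul_one]
  exact Nat.lt_succ_iff.mp (Finset.mem_range.mp hm)

lemma eval_one_iteratePoly {n : ℕ} (C : Matrix (Fin (n + 1)) (Fin (n + 1)) ℝ) :
    (iteratePoly C).eval 1 = 1 := by
  rw [iteratePoly, eval_finsetSum, Finset.sum_range_succ', Finset.sum_eq_zero]
  · simp [powRow_zero]
  · intro m _; simp

lemma IsIterates.eq_aeval {n : ℕ} {H : Matrix (Fin n) (Fin n) ℝ} {X : Type} [AddCommGroup X]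
    [Module ℝ X] {U : X →ₗ[ℝ] X} {y : ℕ → X} (hy : IsIterates H U y) :
    y n = aeval U (iteratePoly (stepSum H)) (y 0) := by
  have h := linear_last_iterate (strictLower_stepSum H) U (y := fun k : Fin (n + 1) => y k)
    (y0 := y 0) (fun k => hy.eq_sub_sum k)
  rw [Fin.val_last] at h
  rw [h, iteratePoly, map_sum (aeval U), LinearMap.sum_apply]
  refine Finset.sum_congr rfl fun m _ => ?_
  rw [map_mul, aeval_C, map_pow, map_sub, aeval_X, map_one, Algebra.algebraMap_eq_smul_one,
    smul_mul_assoc, one_mul, LinearMap.smul_apply]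

lemma aeval_twist_single {n : ℕ} {p : ℝ[X]} (hp : p.natDegree < n + 1) (i : Fin (n + 1)) :
    (aeval (twist n) p (EuclideanSpace.single 0 1)) i = p.coeff i := by
  rw [aeval_eq_sum_range' hp, ← Fin.sum_univ_eq_sum_range (fun i => p.coeff i • twist n ^ i)]
  simp [twist_pow_single, LinearMap.sum_apply, Pi.single_apply]

/-- All coefficients of the iterate polynomial of an optimal algorithm agree, by the equality case
of the Cauchy–Schwarz inequality for the twisted shift started at `∑ i, e_i`. -/
lemma IsOptimal.coeff_iteratePoly {n : ℕ} {H : Matrix (Fin n) (Fin n) ℝ} (hH : IsOptimal H)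
    (i : Fin (n + 1)) : (iteratePoly (stepSum H)).coeff i = 1 / ((n : ℝ) + 1) := by
  set p : ℝ[X] := iteratePoly (stepSum H) with hp
  set e : EuclideanSpace ℝ (Fin (n + 1)) := EuclideanSpace.single 0 1 with he
  set v : EuclideanSpace ℝ (Fin (n + 1)) := ∑ i ∈ Finset.range (n + 1), (twist n ^ i) e with hv
  have hvi : ∀ i, v i = 1 := by
    intro i
    rw [hv, ← Fin.sum_univ_eq_sum_range (fun i => (twist n ^ i) e)]
    simp [he, twist_pow_single]
  have hpe : ∀ i : Fin (n + 1), (aeval (twist n) p e) i = p.coeff i :=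
    aeval_twist_single (natDegree_iteratePoly_lt _)
  have hv2 : v - twist n v = (2 : ℝ) • e := by
    have h2 : (twist n - 1) * (∑ i ∈ Finset.range (n + 1), twist n ^ i) = -1 - 1 := by
      rw [mul_geom_sum, twist_pow_card]
    have h3 := LinearMap.congr_fun h2 e
    simp only [Module.End.mul_apply, LinearMap.sum_apply, LinearMap.sub_apply,
      Module.End.one_apply, LinearMap.neg_apply] at h3
    rw [← hv] at h3
    rw [two_smul, ← neg_sub, h3]; abel
  obtain ⟨y, hy0, hy⟩ := exists_isIterates H (twist n) v
  have hyn : y n = aeval (twist n) p v := by rw [hy.eq_aeval, hy0]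
  have hA : y n - twist n (y n) = (2 : ℝ) • aeval (twist n) p e := by
    have hc : twist n * aeval (twist n) p = aeval (twist n) p * twist n := by
      have := congrArg (aeval (twist n)) (mul_comm X p)
      simpa using this
    have h1 : twist n (aeval (twist n) p v) = aeval (twist n) p (twist n v) :=
      LinearMap.congr_fun hc v
    rw [hyn, h1, ← map_sub, hv2, map_smul]
  have hopt := hH.2 _ (twist n) 0 y
    (fun u v => by rw [← map_sub, norm_twist]) (map_zero _) hy
  have hnv : ‖v‖ ^ 2 = (n : ℝ) + 1 := by
    rw [EuclideanSpace.real_norm_sq_eq]; simp [hvi]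
  have hin : inner ℝ (aeval (twist n) p e) v = 1 := by
    rw [← eval_one_iteratePoly (stepSum H), ← hp, eval_eq_sum_range' (natDegree_iteratePoly_lt _), ← Fin.sum_univ_eq_sum_range (fun i => p.coeff i * 1 ^ i)]
    simp [PiLp.inner_apply, hpe, hvi]
  rw [hA, hy0, sub_zero, hnv] at hopt
  have hzero : ‖(2 : ℝ) • aeval (twist n) p e - (2 / ((n : ℝ) + 1)) • v‖ ^ 2 ≤ 0 := by
    rw [norm_sub_sq_real, inner_smul_left, inner_smul_right, hin,
      norm_smul (2 / ((n : ℝ) + 1)), mul_pow, hnv, Real.norm_eq_abs, sq_abs]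
    have h4 : 4 * ((n : ℝ) + 1) / ((n : ℝ) + 1) ^ 2 = 4 / ((n : ℝ) + 1) := by field_simp
    have h5 : (2 / ((n : ℝ) + 1)) ^ 2 * ((n : ℝ) + 1) = 4 / ((n : ℝ) + 1) := by field_simp; norm_num
    have h6 : 2 * ((starRingEnd ℝ) 2 * (2 / ((n : ℝ) + 1) * 1)) = 2 * (4 / ((n : ℝ) + 1)) := by
      simp only [conj_trivial]; field_simp; norm_num
    rw [h4] at hopt
    rw [h5, h6]
    linarith
  have hz2 := norm_eq_zero.mp (pow_eq_zero_iff two_ne_zero |>.mp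
    (le_antisymm hzero (sq_nonneg _)))
  have h7 := congrArg (fun w : EuclideanSpace ℝ (Fin (n + 1)) => w i) hz2
  simp [hpe, hvi] at h7
  rw [one_div]
  rw [div_eq_mul_inv] at h7
  linarith

/-- The H-invariants of an optimal algorithm. -/
lemma IsOptimal.sum_powRow {n : ℕ} {H : Matrix (Fin n) (Fin n) ℝ} (hH : IsOptimal H) {m : ℕ}
    (hm : m ≤ n) :
    ∑ j, powRow (stepSum H) m j = ((n + 1).choose (m + 1) : ℝ) / ((n : ℝ) + 1) := by
  have hc := hH.coeff_iteratePoly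
  set s : ℕ → ℝ := fun m => ∑ j, powRow (stepSum H) m j with hs
  have hdeg := natDegree_iteratePoly_lt (stepSum H)
  have hp : iteratePoly (stepSum H) = ∑ m ∈ Finset.range (n + 1), C (s m) * (X - 1) ^ m := rfl
  set p : ℝ[X] := iteratePoly (stepSum H)
  have hpe : p = C (1 / ((n : ℝ) + 1)) * ∑ i ∈ Finset.range (n + 1), X ^ i := by
    ext i
    have hg : (∑ i ∈ Finset.range (n + 1), (X : ℝ[X]) ^ i).coeff i =
        if i < n + 1 then 1 else 0 := by
      simp only [finsetSum_coeff, coeff_X_pow, Finset.sum_ite_eq, Finset.mem_range]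
    rw [coeff_C_mul, hg]
    split_ifs with hi
    · rw [mul_one]; exact hc ⟨i, hi⟩
    · rw [mul_zero]; exact coeff_eq_zero_of_natDegree_lt (by omega)
  have h1 : p.comp (X + 1) = ∑ m ∈ Finset.range (n + 1), C (s m) * X ^ m := by
    rw [hp, Polynomial.sum_comp]
    simp
  have h2 : p.comp (X + 1) * X = C (1 / ((n : ℝ) + 1)) * ((X + 1) ^ (n + 1) - 1) := by
    rw [← geom_sum_mul, hpe, mul_comp, C_comp, Polynomial.sum_comp]
    simp [mul_assoc]
  rw [h1] at h2
  have h3 := congrArg (fun q : ℝ[X] => q.coeff (m + 1)) h2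
  simp only [coeff_mul_X, finsetSum_coeff, coeff_C_mul, coeff_X_pow, coeff_sub,
    coeff_X_add_one_pow, coeff_one] at h3
  simp only [mul_ite, mul_one, mul_zero, Finset.sum_ite_eq, Finset.mem_range,
    Nat.lt_succ_of_le hm, if_true] at h3
  change s m = _
  rw [h3]
  simp
  ring

end polynomial

/-- Alternating binomial sums annihilate polynomials of lower degree. -/
lemma sum_alternating_choose (N : ℕ) : ∀ l a : ℕ, l < N →
    ∑ m ∈ Finset.range (N + 1), (-1 : ℝ) ^ m * ((a + m).choose l : ℝ) * (N.choose m : ℝ) = 0 := by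
  induction N with
  | zero => intro l a h; omega
  | succ N ih =>
    intro l a hl
    have pascal : ∑ m ∈ Finset.range (N + 2), (-1 : ℝ) ^ m * ((a + m).choose l : ℝ) *
        ((N + 1).choose m : ℝ) = ∑ m ∈ Finset.range (N + 1), (-1 : ℝ) ^ m *
          (((a + m).choose l : ℝ) - ((a + m + 1).choose l : ℝ)) * (N.choose m : ℝ) := by
      have h1 : ∑ m ∈ Finset.range (N + 1), (-1 : ℝ) ^ m * ((a + m).choose l : ℝ) *
          (N.choose m : ℝ) = ∑ m ∈ Finset.range (N + 1), (-1 : ℝ) ^ (m + 1) *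
          ((a + m + 1).choose l : ℝ) * (N.choose (m + 1) : ℝ) + (a.choose l : ℝ) := by
        rw [Finset.sum_range_succ', Finset.sum_range_succ (n := N) (f := fun m =>
          (-1 : ℝ) ^ (m + 1) * ((a + m + 1).choose l : ℝ) * (N.choose (m + 1) : ℝ))]
        simp [add_assoc]
      simp only [mul_sub, sub_mul, Finset.sum_sub_distrib]
      rw [h1, Finset.sum_range_succ' _ (N + 1)]
      simp only [Nat.choose_succ_succ, Nat.cast_add, mul_add, Finset.sum_add_distrib, add_zero,
        Nat.choose_zero_right, pow_zero, one_mul, Nat.cast_one, mul_one, ← add_assoc, pow_succ]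
      simp only [mul_neg, neg_mul, mul_one, Finset.sum_neg_distrib]
      ring
    rw [pascal]
    cases l with
    | zero => simp
    | succ l =>
      have h2 : ∀ m, (((a + m).choose (l + 1) : ℝ) - ((a + m + 1).choose (l + 1) : ℝ)) =
          - ((a + m).choose l : ℝ) := by
        intro m; rw [Nat.choose_succ_succ]; push_cast; ring
      simp only [h2, mul_neg, neg_mul, Finset.sum_neg_distrib]
      rw [ih l a (by omega), neg_zero]

lemma IsOptimal.rowSum {n : ℕ} {H : Matrix (Fin n) (Fin n) ℝ} (hH : IsOptimal H)
    (a : Fin (n + 1)) :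
    ∑ b, certMatrix (stepSum H) a b = if a = Fin.last n then 1 else 0 := by
  have hN : ((n : ℝ) + 1) ≠ 0 := by positivity
  have inner_sum : ∀ l ∈ Finset.range (n + 1), ∑ m ∈ Finset.range (n + 1),
      (-1 : ℝ) ^ m * ((l + m).choose m : ℝ) * ((n + 1).choose (m + 1) : ℝ) =
        if l = 0 then 1 else 0 := by
    intro l hl
    rw [Finset.mem_range] at hl
    cases l with
    | zero =>
      have h := sum_alternating_choose (n + 1) 0 0 (by omega)
      rw [Finset.sum_range_succ'] at h
      simp only [Nat.choose_zero_right, Nat.cast_one, mul_one, pow_succ, pow_zero, mul_neg,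
        neg_mul, Finset.sum_neg_distrib] at h
      simp only [zero_add, Nat.choose_self, Nat.cast_one, mul_one, if_true]
      linarith
    | succ l =>
      have h := sum_alternating_choose (n + 1) (l + 1) l (by omega)
      rw [Finset.sum_range_succ'] at h
      simp only [add_zero, Nat.choose_succ_self, Nat.cast_zero, mul_zero, zero_mul,
        pow_succ, mul_neg, neg_mul, Finset.sum_neg_distrib, mul_one, neg_eq_zero] at h
      rw [if_neg (by omega), ← h]
      refine Finset.sum_congr rfl fun m _ => ?_
      rw [← Nat.choose_symm_add, show l + 1 + m = l + (m + 1) by ring]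
  have e : ∑ b, certMatrix (stepSum H) a b = ∑ l ∈ Finset.range (n + 1),
      ((-1 : ℝ) ^ l * powRow (stepSum H) l a) * ∑ m ∈ Finset.range (n + 1),
      (-1 : ℝ) ^ m * ((l + m).choose m : ℝ) * ((n + 1).choose (m + 1) : ℝ) := by
    simp only [certMatrix, Matrix.of_apply]
    rw [← Finset.mul_sum, Finset.sum_comm, Finset.mul_sum]
    refine Finset.sum_congr rfl fun l _ => ?_
    rw [Finset.sum_comm, Finset.mul_sum, Finset.mul_sum]
    refine Finset.sum_congr rfl fun m hm => ?_
    rw [← Finset.mul_sum, hH.sum_powRow (by rw [Finset.mem_range] at hm; omega), pow_add]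
    field_simp
  rw [e, Finset.sum_congr rfl fun l hl => by rw [inner_sum l hl]]
  rw [Finset.sum_range_succ']
  simp [powRow_zero]

/-- On the extreme antidiagonal the powers of `C` have nonzero last rows, as the last invariant is
the product of the subdiagonal entries of `C`. -/
lemma IsOptimal.powRow_ne_zero {n : ℕ} {H : Matrix (Fin n) (Fin n) ℝ} (hH : IsOptimal H)
    {m : ℕ} {j : Fin (n + 1)} (hm : j + m = n) : powRow (stepSum H) m j ≠ 0 := by
  have hlow := strictLower_stepSum H
  have key : ∀ d m : ℕ, ∀ j : Fin (n + 1), j = d → j + m = n → powRow (stepSum H) m j ≠ 0 := by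
    intro d
    induction d with
    | zero =>
      intro m j hj hm
      have h := hH.sum_powRow (m := m) (by omega)
      rw [Finset.sum_eq_single j] at h
      · rw [h]
        have : m = n := by omega
        subst this
        rw [Nat.choose_self]
        positivity
      · intro b _ hb
        have : (b : ℕ) ≠ j := fun h => hb (Fin.ext h)
        exact powRow_eq_zero hlow _ _ (by omega)
      · simp
    | succ d ih =>
      intro m j hj hm h0
      have hjlt := j.2
      refine ih (m + 1) ⟨d, by omega⟩ rfl (by simp; omega) ?_
      rw [powRow_succ]
      refine Finset.sum_eq_zero fun k _ => ?_
      rcases lt_trichotomy k j with h | h | h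
      · have : (k : ℕ) < j := h
        rw [hlow k _ (by change (k : ℕ) ≤ d; omega), mul_zero]
      · rw [h, h0, zero_mul]
      · have : (j : ℕ) < k := h
        rw [powRow_eq_zero hlow _ _ (by omega), zero_mul]
  exact key j m j rfl hm

lemma IsOptimal.stepSum_ne_zero {n : ℕ} {H : Matrix (Fin n) (Fin n) ℝ} (hH : IsOptimal H)
    (a : Fin n) : stepSum H a.succ a.castSucc ≠ 0 := by
  intro h0
  have hlow := strictLower_stepSum H
  refine hH.powRow_ne_zero (m := n - a) (j := a.castSucc) (by simp) ?_
  rw [show n - (a : ℕ) = (n - a - 1) + 1 by omega, powRow_succ]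
  refine Finset.sum_eq_zero fun k _ => ?_
  rcases lt_trichotomy k a.succ with h | h | h
  · rw [hlow k _ (Fin.le_castSucc_iff.mpr h), mul_zero]
  · rw [h, h0, mul_zero]
  · have : (a : ℕ) + 1 < k := h
    rw [powRow_eq_zero hlow _ _ (by omega), zero_mul]

/-- Every node other than the last has an arc to a later node. Otherwise its unit vector `e_j` lies in
the kernel of `M`, and so do all `C ^ m *ᵥ e_j`, while all vectors in the kernel have last coordinate
`0`. This contradicts `powRow_ne_zero`. -/
lemma IsOptimal.exists_ne_zero {n : ℕ} {H : Matrix (Fin n) (Fin n) ℝ} (hH : IsOptimal H)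
    {M : Matrix (Fin (n + 1)) (Fin (n + 1)) ℝ} (hM : IsCertificate (stepSum H) M)
    (a : Fin n) : ∃ b, a.castSucc < b ∧ M a.castSucc b ≠ 0 := by
  by_contra! hcon
  set j := a.castSucc with hj
  set C := stepSum H with hC
  have hlow : StrictLower C := strictLower_stepSum H
  have hjn : j ≠ Fin.last n := (Fin.castSucc_lt_last a).ne
  -- The diagonal entry of the Lyapunov equation at `j` reduces to `M j j = 0`.
  have hjj : M j j = 0 := by
    have h := hM.lyapunov j j
    rw [if_neg (fun h => hjn h.1)] at h
    have e1 : (M * C) j j = 0 := by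
      rw [Matrix.mul_apply]
      refine Finset.sum_eq_zero fun k _ => ?_
      rcases le_or_gt k j with hk | hk
      · rw [hlow k j hk, mul_zero]
      · rw [hcon k hk, zero_mul]
    have e2 : (Cᵀ * M) j j = 0 := by
      rw [Matrix.mul_apply]
      refine Finset.sum_eq_zero fun k _ => ?_
      rw [Matrix.transpose_apply]
      rcases le_or_gt k j with hk | hk
      · rw [hlow k j hk, zero_mul]
      · rw [hM.symm, hcon k hk, mul_zero]
    rw [e1, e2] at h
    linarith
  have hrow : ∀ b, M j b = 0 := by
    have hs := hM.rowSum j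
    rw [if_neg hjn, Finset.sum_eq_zero_iff_of_nonpos] at hs
    · exact fun b => hs b (Finset.mem_univ b)
    · intro b _
      rcases eq_or_ne j b with h | h
      · rw [← h, hjj]
      · exact hM.nonpos j b h
  -- The kernel of `M` is invariant under `C` and its vectors have last coordinate `0`.
  have ker : ∀ v : Fin (n + 1) → ℝ, M *ᵥ v = 0 → v (Fin.last n) = 0 ∧ M *ᵥ (C *ᵥ v) = 0 := by
    intro v hv
    have hmat : (M * C + Cᵀ * M + M) *ᵥ v =
        Pi.single (Fin.last n) (((n : ℝ) + 1) * v (Fin.last n)) := by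
      ext i
      simp only [Matrix.mulVec, dotProduct, Matrix.add_apply, hM.lyapunov _ _, ite_and, ite_mul,
        zero_mul, Pi.single_apply]
      split_ifs <;> simp
    rw [Matrix.add_mulVec, Matrix.add_mulVec, ← Matrix.mulVec_mulVec, ← Matrix.mulVec_mulVec, hv,
      Matrix.mulVec_zero, add_zero, add_zero] at hmat
    have hsym : Mᵀ = M := by ext i k; exact hM.symm k i
    have hdot : v ⬝ᵥ (M *ᵥ (C *ᵥ v)) = 0 := by
      rw [Matrix.dotProduct_mulVec, ← Matrix.mulVec_transpose, hsym, hv, zero_dotProduct]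
    have hl : v (Fin.last n) = 0 := by
      rw [hmat, dotProduct_single] at hdot
      have hN : ((n : ℝ) + 1) ≠ 0 := by positivity
      rcases mul_eq_zero.mp hdot with h | h
      · exact h
      · exact (mul_eq_zero.mp h).resolve_left hN
    exact ⟨hl, by rw [hmat, hl, mul_zero, Pi.single_zero]⟩
  have pw : ∀ m, M *ᵥ ((C ^ m) *ᵥ Pi.single j 1) = 0 := by
    intro m
    induction m with
    | zero =>
      ext i
      rw [pow_zero, Matrix.one_mulVec, Matrix.mulVec_single_one]
      exact (hM.symm _ _).trans (hrow i)
    | succ m ih =>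
      rw [pow_succ', ← Matrix.mulVec_mulVec]
      exact (ker _ ih).2
  have h0 := (ker _ (pw (n - a))).1
  rw [Matrix.mulVec_single_one] at h0
  exact hH.powRow_ne_zero (m := n - a) (j := j) (by simp [hj]) h0

/-! ### Nonnegativity of the certificates of optimal algorithms -/

section bending

open Filter Topology Asymptotics

/-- The twisted shift after the map `x ↦ x - ε * max 0 ⟪a, x⟫ • a`, a gradient step on the convex
function `x ↦ (max 0 ⟪a, x⟫)² / 2`. -/
noncomputable def bentTwist (n : ℕ) (a : EuclideanSpace ℝ (Fin (n + 1))) (ε : ℝ)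
    (x : EuclideanSpace ℝ (Fin (n + 1))) : EuclideanSpace ℝ (Fin (n + 1)) :=
  twist n (x - (ε * max 0 (inner ℝ a x)) • a)

lemma bentTwist_zero (n : ℕ) (a : EuclideanSpace ℝ (Fin (n + 1))) :
    bentTwist n a 0 = twist n := by
  ext x; simp [bentTwist]

lemma inner_bentTwist {n : ℕ} (a x y : EuclideanSpace ℝ (Fin (n + 1))) (ε : ℝ) :
    inner ℝ x y - inner ℝ (bentTwist n a ε x) (bentTwist n a ε y) =
      ε * (max 0 (inner ℝ a x) * inner ℝ a y + max 0 (inner ℝ a y) * inner ℝ a x -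
        ε * ‖a‖ ^ 2 * (max 0 (inner ℝ a x) * max 0 (inner ℝ a y))) := by
  rw [bentTwist, bentTwist, inner_twist]
  simp only [inner_sub_left, inner_sub_right, inner_smul_left, inner_smul_right, conj_trivial,
    real_inner_self_eq_norm_sq]
  rw [real_inner_comm a x]
  ring

lemma norm_bentTwist_sub_le {n : ℕ} {a : EuclideanSpace ℝ (Fin (n + 1))} {ε : ℝ} (h0 : 0 ≤ ε)
    (hε : ε * ‖a‖ ^ 2 ≤ 2) (x y : EuclideanSpace ℝ (Fin (n + 1))) :
    ‖bentTwist n a ε x - bentTwist n a ε y‖ ≤ ‖x - y‖ := by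
  rw [← sq_le_sq₀ (norm_nonneg _) (norm_nonneg _), ← sub_nonneg]
  set d := max 0 (inner ℝ a x) - max 0 (inner ℝ a y) with hd
  set s := inner ℝ a x - inner ℝ a y with hs
  have hdiff : bentTwist n a ε x - bentTwist n a ε y = twist n ((x - y) - (ε * d) • a) := by
    rw [bentTwist, bentTwist, ← map_sub]
    congr 1
    rw [hd, mul_sub, sub_smul]; abel
  have hmono : d ^ 2 ≤ d * s := by
    rcases le_total (inner ℝ a x) 0 with h1 | h1 <;> rcases le_total (inner ℝ a y) 0 with h2 | h2 <;>
      simp only [hd, hs, max_eq_left, max_eq_right, h1, h2] <;> nlinarith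
  rw [hdiff, norm_twist, norm_sub_sq_real (x - y), norm_smul, inner_smul_right, real_inner_comm,
    inner_sub_right, ← hs, mul_pow, Real.norm_eq_abs, sq_abs]
  have : 0 ≤ ε * (2 * (d * s) - ε * ‖a‖ ^ 2 * d ^ 2) := by
    refine mul_nonneg h0 ?_
    nlinarith [mul_le_mul_of_nonneg_right hε (sq_nonneg d)]
  nlinarith

lemma tendsto_of_sub_isBigO {E : Type*} [NormedAddCommGroup E] {f : ℝ → E} {c : E}
    (h : (fun ε => f ε - c) =O[𝓝 0] fun ε : ℝ => ε) : Tendsto f (𝓝 0) (𝓝 c) :=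
  tendsto_sub_nhds_zero_iff.mp (h.trans_tendsto tendsto_id)

lemma bentTwist_sub_isBigO {n : ℕ} (a c : EuclideanSpace ℝ (Fin (n + 1)))
    {f : ℝ → EuclideanSpace ℝ (Fin (n + 1))} (h : (fun ε => f ε - c) =O[𝓝 0] fun ε : ℝ => ε) :
    (fun ε => bentTwist n a ε (f ε) - bentTwist n a 0 c) =O[𝓝 0] fun ε : ℝ => ε := by
  have e : ∀ ε, bentTwist n a ε (f ε) - bentTwist n a 0 c =
      twist n (f ε - c) - ε • (max 0 (inner ℝ a (f ε)) • twist n a) := by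
    intro ε
    simp only [bentTwist, map_sub, map_smul, zero_mul, zero_smul, sub_zero, smul_smul]
    abel
  simp only [e]
  refine IsBigO.sub ?_ ?_
  · exact (IsBigO.of_bound 1 (Eventually.of_forall fun ε => by rw [norm_twist, one_mul])).trans h
  · have ht : Tendsto (fun ε => max 0 (inner ℝ a (f ε)) • twist n a) (𝓝 0)
        (𝓝 (max 0 (inner ℝ a c) • twist n a)) := by
      refine Tendsto.smul_const ?_ _
      exact tendsto_const_nhds.max (tendsto_const_nhds.inner (tendsto_of_sub_isBigO h))
    have := (isBigO_refl (fun ε : ℝ => ε) (𝓝 0)).smul (ht.isBigO_one ℝ)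
    simpa using this

lemma iterates_sub_isBigO {n : ℕ} {H : Matrix (Fin n) (Fin n) ℝ}
    {a : EuclideanSpace ℝ (Fin (n + 1))} {Y : ℝ → ℕ → EuclideanSpace ℝ (Fin (n + 1))}
    (hY0 : ∀ ε, Y ε 0 = Y 0 0) (hY : ∀ ε, IsIterates H (bentTwist n a ε) (Y ε))
    (k : Fin (n + 1)) : (fun ε => Y ε k - Y 0 k) =O[𝓝 0] fun ε : ℝ => ε := by
  induction k using WellFoundedLT.induction with
  | _ k ih =>
    have e : ∀ ε, Y ε k - Y 0 k = - ∑ l : Fin (n + 1), stepSum H k l • ((Y ε l - Y 0 l) -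
        (bentTwist n a ε (Y ε l) - bentTwist n a 0 (Y 0 l))) := by
      intro ε
      rw [(hY ε).eq_sub_sum k, (hY 0).eq_sub_sum k, hY0 ε, sub_sub_sub_cancel_left,
        ← Finset.sum_sub_distrib, ← Finset.sum_neg_distrib]
      refine Finset.sum_congr rfl fun l _ => ?_
      rw [← smul_sub, ← smul_neg]
      congr 1
      abel
    simp only [e]
    refine IsBigO.neg_left (IsBigO.fun_sum fun l _ => ?_)
    rcases le_or_gt k l with h | h
    · simp only [strictLower_stepSum H k l h, zero_smul]
      exact isBigO_zero _ _
    · exact ((ih l h).sub (bentTwist_sub_isBigO a _ (ih l h))).const_smul_left (stepSum H k l)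

/-- The iterates of the twisted shift started at `e_0` are linearly independent: their coordinates
form a triangular matrix with nonzero diagonal. -/
lemma IsOptimal.exists_inner_eq {n : ℕ} {H : Matrix (Fin n) (Fin n) ℝ} (hH : IsOptimal H)
    {y : ℕ → EuclideanSpace ℝ (Fin (n + 1))} (hy : IsIterates H (twist n) y)
    (hy0 : y 0 = EuclideanSpace.single 0 1) (t : Fin (n + 1) → ℝ) :
    ∃ a : EuclideanSpace ℝ (Fin (n + 1)), ∀ k : Fin (n + 1), inner ℝ a (y k) = t k := by
  have coord : ∀ k i : Fin (n + 1), y k i = (if i = 0 then 1 else 0) -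
      ∑ l : Fin (n + 1), stepSum H k l * (y l i - twist n (y l) i) := by
    intro k i
    have h := congrArg (fun w : EuclideanSpace ℝ (Fin (n + 1)) => w i) (hy.eq_sub_sum k)
    simpa [hy0, Pi.single_apply] using h
  have upper : ∀ k i : Fin (n + 1), k < i → y k i = 0 := by
    intro k
    induction k using WellFoundedLT.induction with
    | _ k ih =>
      intro i hi
      obtain ⟨i, rfl⟩ := Fin.exists_succ_eq.mpr (ne_of_gt (lt_of_le_of_lt (Fin.zero_le k) hi))
      rw [coord, if_neg (Fin.succ_ne_zero i), zero_sub, neg_eq_zero]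
      refine Finset.sum_eq_zero fun l _ => ?_
      rcases le_or_gt k l with h | h
      · rw [strictLower_stepSum H k l h, zero_mul]
      · rw [twist_succ, ih l h _ (h.trans hi), ih l h _ (lt_of_lt_of_le h (Fin.le_castSucc_iff.mpr hi)),
          sub_self, mul_zero]
  have diag : ∀ k : Fin (n + 1), y k k ≠ 0 := by
    intro k
    induction k using Fin.induction with
    | zero => simp [hy0]
    | succ k ih =>
      have e : y k.succ k.succ = stepSum H k.succ k.castSucc * y k.castSucc k.castSucc := by
        rw [coord, if_neg (Fin.succ_ne_zero k), Finset.sum_eq_single k.castSucc]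
        · rw [twist_succ, upper _ _ (Fin.castSucc_lt_succ)]; ring
        · intro l _ hl
          rcases lt_or_gt_of_ne hl with h | h
          · rw [twist_succ, upper _ _ h, upper _ _ (h.trans Fin.castSucc_lt_succ)]; simp
          · rw [strictLower_stepSum H _ l (Fin.castSucc_lt_iff_succ_le.mp h), zero_mul]
        · simp
      rw [e]
      exact mul_ne_zero (hH.stepSum_ne_zero k) ih
  set Y : Matrix (Fin (n + 1)) (Fin (n + 1)) ℝ := Matrix.of fun k i => y k i with hYdef
  have hdet : IsUnit Y.det := by
    rw [Matrix.det_of_isLowerTriangular Y (fun i j h => upper i j h), isUnit_iff_ne_zero,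
      Finset.prod_ne_zero_iff]
    exact fun k _ => diag k
  refine ⟨WithLp.toLp 2 (Y⁻¹ *ᵥ t), fun k => ?_⟩
  have h := congrFun (show Y *ᵥ (Y⁻¹ *ᵥ t) = t by
    rw [Matrix.mulVec_mulVec, Matrix.mul_nonsing_inv _ hdet, Matrix.one_mulVec]) k
  rw [← h]
  simp [PiLp.inner_apply, Matrix.mulVec, dotProduct, hYdef]

/-- The twisted shift attains the optimal bound at `e_0`. In the gap identity for the bent shift, the
square is of second order in `ε`, so the first-order part of the other sum is nonnegative. Here
`t k = ⟪a, y k⟫` can be prescribed, by linear independence of the iterates. -/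
lemma IsOptimal.sum_bend_nonneg {n : ℕ} {H : Matrix (Fin n) (Fin n) ℝ} (hH : IsOptimal H)
    (t : Fin (n + 1) → ℝ) : 0 ≤ ∑ k, ∑ j, certMatrix (stepSum H) k j *
      (max 0 (t k) * t j + max 0 (t j) * t k) := by
  set M := certMatrix (stepSum H) with hM
  have hN : (0 : ℝ) < (n : ℝ) + 1 := by positivity
  obtain ⟨y, hy0, hy⟩ := exists_isIterates H (twist n) (EuclideanSpace.single 0 1)
  obtain ⟨a, ha⟩ := hH.exists_inner_eq hy hy0 t
  have hex : ∀ ε : ℝ, ∃ z : ℕ → EuclideanSpace ℝ (Fin (n + 1)), (ε = 0 → z = y) ∧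
      z 0 = EuclideanSpace.single 0 1 ∧ IsIterates H (bentTwist n a ε) z := by
    intro ε
    rcases eq_or_ne ε 0 with rfl | h
    · exact ⟨y, fun _ => rfl, hy0, by rw [bentTwist_zero]; exact hy⟩
    · obtain ⟨z, hz⟩ := exists_isIterates H (bentTwist n a ε) (EuclideanSpace.single 0 1)
      exact ⟨z, fun h0 => absurd h0 h, hz⟩
  choose Y hYy hY0 hY using hex
  have hYy := hYy 0 rfl
  have hbig := iterates_sub_isBigO (fun ε => by rw [hY0, hY0]) hY
  -- At `ε = 0` the residual is `2 / (n + 1)` times the starting point.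
  have hres : (2 / ((n : ℝ) + 1)) • y 0 - (y n - twist n (y n)) = 0 := by
    have hc : ∀ i, y n i = 1 / ((n : ℝ) + 1) := by
      intro i
      rw [hy.eq_aeval, hy0, aeval_twist_single (natDegree_iteratePoly_lt _), hH.coeff_iteratePoly]
    ext i
    refine Fin.cases ?_ (fun i => ?_) i
    · simp only [PiLp.sub_apply, PiLp.smul_apply, PiLp.zero_apply, hc, twist_zero, hy0]
      simp
      ring
    · simp only [PiLp.sub_apply, PiLp.smul_apply, PiLp.zero_apply, hc, twist_succ, hy0]
      simp
  set r : ℝ → EuclideanSpace ℝ (Fin (n + 1)) := fun ε =>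
    (2 / ((n : ℝ) + 1)) • Y ε 0 - (Y ε n - bentTwist n a ε (Y ε n)) with hr
  have hrO : r =O[𝓝 0] fun ε : ℝ => ε := by
    have hl := hbig (Fin.last n)
    rw [Fin.val_last] at hl
    have e : ∀ ε, r ε = - ((Y ε n - Y 0 n) - (bentTwist n a ε (Y ε n) - bentTwist n a 0 (Y 0 n))) := by
      intro ε
      rw [← sub_zero (r ε), ← hres, hr]
      simp only [hYy, bentTwist_zero, hY0, hy0]
      abel
    rw [show r = _ from funext e]
    exact (hl.sub (bentTwist_sub_isBigO a _ hl)).neg_left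
  set F : ℝ → ℝ := fun ε => ∑ k : Fin (n + 1), ∑ j : Fin (n + 1), M k j *
    (max 0 (inner ℝ a (Y ε k)) * inner ℝ a (Y ε j) + max 0 (inner ℝ a (Y ε j)) * inner ℝ a (Y ε k) -
      ε * ‖a‖ ^ 2 * (max 0 (inner ℝ a (Y ε k)) * max 0 (inner ℝ a (Y ε j)))) with hF
  have hin : ∀ k : Fin (n + 1), Tendsto (fun ε => inner ℝ a (Y ε k)) (𝓝 0) (𝓝 (t k)) := by
    intro k
    rw [← ha, ← hYy]
    exact tendsto_const_nhds.inner (tendsto_of_sub_isBigO (hbig k))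
  have hFlim : Tendsto F (𝓝 0) (𝓝 (∑ k, ∑ j, M k j *
      (max 0 (t k) * t j + max 0 (t j) * t k))) := by
    refine tendsto_finsetSum _ fun k _ => tendsto_finsetSum _ fun j _ => ?_
    refine Tendsto.const_mul _ ?_
    have hmax : ∀ k : Fin (n + 1), Tendsto (fun ε => max 0 (inner ℝ a (Y ε k))) (𝓝 0)
        (𝓝 (max 0 (t k))) := fun k => tendsto_const_nhds.max (hin k)
    have h1 := ((hmax k).mul (hin j)).add ((hmax j).mul (hin k))
    have h2 := ((tendsto_id (x := 𝓝 (0 : ℝ))).mul_const (‖a‖ ^ 2)).mul ((hmax k).mul (hmax j))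
    have h3 := h1.sub h2
    simpa using h3
  have hrlim : Tendsto (fun ε => ‖r ε‖ ^ 2 / ε) (𝓝[>] 0) (𝓝 0) := by
    have h1 : (fun ε => ‖r ε‖ ^ 2) =o[𝓝 0] fun ε : ℝ => ε := by
      have h2 : (fun ε => ‖r ε‖ ^ 2) =O[𝓝 0] fun ε : ℝ => ε ^ 2 := hrO.norm_left.pow 2
      exact h2.trans_isLittleO (isLittleO_pow_id one_lt_two)
    exact h1.tendsto_div_nhds_zero.mono_left nhdsWithin_le_nhds
  have hineq : ∀ᶠ ε in 𝓝[>] (0 : ℝ), 0 ≤ ‖r ε‖ ^ 2 / ε + 2 / ((n : ℝ) + 1) * F ε := by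
    have hsmall : ∀ᶠ ε in 𝓝[>] (0 : ℝ), ε * ‖a‖ ^ 2 < 2 := by
      have : Tendsto (fun ε : ℝ => ε * ‖a‖ ^ 2) (𝓝 0) (𝓝 (0 * ‖a‖ ^ 2)) :=
        tendsto_id.mul_const _
      rw [zero_mul] at this
      exact (this.mono_left nhdsWithin_le_nhds).eventually (gt_mem_nhds two_pos)
    filter_upwards [hsmall, self_mem_nhdsWithin] with ε hε hpos
    have hpos : (0 : ℝ) < ε := hpos
    have hfix : bentTwist n a ε 0 = 0 := by simp [bentTwist]
    have hopt := hH.2 _ (bentTwist n a ε) 0 (Y ε)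
      (norm_bentTwist_sub_le hpos.le hε.le) hfix (hY ε)
    have hgap := gap_identity (u := fun k : Fin (n + 1) => Y ε k)
      (v := fun k : Fin (n + 1) => bentTwist n a ε (Y ε k))
      (isLyapunov_certMatrix (strictLower_stepSum H)) (certMatrix_symm _) hH.rowSum
      (hY ε).eq_sub_sum
    simp only [Fin.val_zero, Fin.val_last, inner_bentTwist] at hgap
    have hFe : ∑ k : Fin (n + 1), ∑ j : Fin (n + 1), certMatrix (stepSum H) k j * (ε *
        (max 0 (inner ℝ a (Y ε k)) * inner ℝ a (Y ε j) +
          max 0 (inner ℝ a (Y ε j)) * inner ℝ a (Y ε k) -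
          ε * ‖a‖ ^ 2 * (max 0 (inner ℝ a (Y ε k)) * max 0 (inner ℝ a (Y ε j))))) = ε * F ε := by
      simp only [hF, Finset.mul_sum]
      refine Finset.sum_congr rfl fun k _ => Finset.sum_congr rfl fun j _ => ?_
      rw [hM]; ring
    rw [hFe] at hgap
    rw [sub_zero] at hopt
    have h0 : 0 ≤ ‖r ε‖ ^ 2 + 2 / ((n : ℝ) + 1) * (ε * F ε) := by
      rw [← hgap]; linarith
    have := div_nonneg h0 hpos.le
    rwa [add_div, mul_left_comm, mul_div_cancel_left₀ _ hpos.ne'] at this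
  have hlim := hrlim.add ((hFlim.mono_left nhdsWithin_le_nhds).const_mul (2 / ((n : ℝ) + 1)))
  rw [zero_add] at hlim
  have h := ge_of_tendsto hlim hineq
  exact nonneg_of_mul_nonneg_right h (by positivity)

lemma IsOptimal.certMatrix_nonpos {n : ℕ} {H : Matrix (Fin n) (Fin n) ℝ} (hH : IsOptimal H)
    (k j : Fin (n + 1)) (hkj : k ≠ j) : certMatrix (stepSum H) k j ≤ 0 := by
  set M := certMatrix (stepSum H) with hM
  -- With `t k = δ`, `t j = -1` and the other values `0`, the sum is `2 δ (δ * M k k - M k j)`.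
  have hδ : ∀ δ : ℝ, 0 < δ → M k j ≤ δ * M k k := by
    intro δ hδ
    have h := hH.sum_bend_nonneg (Pi.single k δ - Pi.single j 1)
    have hmax : ∀ i, max 0 ((Pi.single k δ - Pi.single j 1 : Fin (n + 1) → ℝ) i) =
        if i = k then δ else 0 := by
      intro i
      rcases eq_or_ne i k with rfl | hik
      · simp [hkj, hδ.le]
      · rcases eq_or_ne i j with rfl | hij <;> simp [*]
    have e : ∑ i, ∑ l, M i l * (max 0 ((Pi.single k δ - Pi.single j 1 : Fin (n + 1) → ℝ) i) *
        (Pi.single k δ - Pi.single j 1 : Fin (n + 1) → ℝ) l +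
        max 0 ((Pi.single k δ - Pi.single j 1 : Fin (n + 1) → ℝ) l) *
        (Pi.single k δ - Pi.single j 1 : Fin (n + 1) → ℝ) i) = 2 * δ * (δ * M k k - M k j) := by
      simp only [hmax, mul_add, Finset.sum_add_distrib]
      simp only [Pi.sub_apply, Pi.single_apply, ite_mul, mul_ite, zero_mul, mul_zero, mul_sub,
        Finset.sum_sub_distrib, Finset.sum_ite_eq', Finset.mem_univ, if_true, mul_one,
        Finset.sum_ite_irrel, Finset.sum_const_zero]
      rw [show M j k = M k j from certMatrix_symm _ _ _]
      ring
    rw [e] at h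
    have := nonneg_of_mul_nonneg_right h (by positivity)
    linarith
  by_contra! hpos
  have h := hδ (M k j / (2 * (|M k k| + 1))) (by positivity)
  have h2 : M k j / (2 * (|M k k| + 1)) * M k k ≤ M k j / (2 * (|M k k| + 1)) * (|M k k| + 1) :=
    mul_le_mul_of_nonneg_left ((le_abs_self _).trans (by linarith)) (by positivity)
  have h3 : M k j / (2 * (|M k k| + 1)) * (|M k k| + 1) = M k j / 2 := by
    have : |M k k| + 1 ≠ 0 := by positivity
    field_simp
  linarith

end bending

theorem IsOptimal.isCertificate {n : ℕ} {H : Matrix (Fin n) (Fin n) ℝ} (hH : IsOptimal H) :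
    IsCertificate (stepSum H) (certMatrix (stepSum H)) where
  lyapunov := isLyapunov_certMatrix (strictLower_stepSum H)
  symm := certMatrix_symm _
  rowSum := hH.rowSum
  nonpos := hH.certMatrix_nonpos

/-! ### The equation for the inverse of the certificate matrix, and duality -/

/-- The equation `C X + X Cᵀ + X = (n + 1) 1 1ᵀ`, solved by the inverse of a certificate matrix. -/
def IsDualLyapunov {n : ℕ} (C X : Matrix (Fin (n + 1)) (Fin (n + 1)) ℝ) : Prop :=
  ∀ a b, (C * X) a b + (X * Cᵀ) a b + X a b = (n : ℝ) + 1

lemma IsDualLyapunov.unique {n : ℕ} {C X X' : Matrix (Fin (n + 1)) (Fin (n + 1)) ℝ}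
    (hC : StrictLower C) (h : IsDualLyapunov C X) (h' : IsDualLyapunov C X') : X = X' := by
  have key : ∀ d : ℕ, ∀ a b : Fin (n + 1), (a : ℕ) + b ≤ d → X a b = X' a b := by
    intro d
    induction d using Nat.strong_induction_on with
    | _ d ih =>
      intro a b hab
      have e := h a b
      have e' := h' a b
      have e1 : (C * X) a b = (C * X') a b := by
        simp only [Matrix.mul_apply]
        refine Finset.sum_congr rfl fun k _ => ?_
        rcases le_or_gt a k with hk | hk
        · rw [hC a k hk]; simp
        · have : (k : ℕ) < a := hk
          rw [ih (k + b) (by omega) k b le_rfl]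
      have e2 : (X * Cᵀ) a b = (X' * Cᵀ) a b := by
        simp only [Matrix.mul_apply, Matrix.transpose_apply]
        refine Finset.sum_congr rfl fun k _ => ?_
        rcases le_or_gt b k with hk | hk
        · rw [hC b k hk]; simp
        · have : (k : ℕ) < b := hk
          rw [ih (a + k) (by omega) a k le_rfl]
      rw [e1, e2] at e
      linarith
  ext a b
  exact key _ a b le_rfl

section inverse

variable {n : ℕ} {C M X : Matrix (Fin (n + 1)) (Fin (n + 1)) ℝ}

lemma isLyapunov_iff : IsLyapunov C M ↔ M * C + Cᵀ * M + M = ((n : ℝ) + 1) •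
    Matrix.vecMulVec (Pi.single (Fin.last n) 1) (Pi.single (Fin.last n) 1) := by
  constructor
  · intro h
    ext a b
    rw [Matrix.add_apply, Matrix.add_apply, h a b]
    simp only [Matrix.smul_apply, Matrix.vecMulVec_apply, Pi.single_apply, smul_eq_mul]
    split_ifs <;> simp_all
  · intro h a b
    rw [← Matrix.add_apply, ← Matrix.add_apply, h]
    simp only [Matrix.smul_apply, Matrix.vecMulVec_apply, Pi.single_apply, smul_eq_mul]
    split_ifs <;> simp_all

lemma isDualLyapunov_iff : IsDualLyapunov C X ↔
    C * X + X * Cᵀ + X = ((n : ℝ) + 1) • Matrix.vecMulVec 1 1 := by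
  constructor
  · intro h
    ext a b
    rw [Matrix.add_apply, Matrix.add_apply, h a b]
    simp
  · intro h a b
    rw [← Matrix.add_apply, ← Matrix.add_apply, h]
    simp

lemma mulVec_one_of_rowSum (hr : ∀ a, ∑ b, M a b = if a = Fin.last n then 1 else 0) :
    M *ᵥ 1 = Pi.single (Fin.last n) 1 := by
  ext a
  simp [Matrix.mulVec, dotProduct, hr, Pi.single_apply]

lemma one_vecMul_of_rowSum (hs : ∀ a b, M a b = M b a)
    (hr : ∀ a, ∑ b, M a b = if a = Fin.last n then 1 else 0) :
    1 ᵥ* M = Pi.single (Fin.last n) 1 := by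
  rw [← mulVec_one_of_rowSum hr, ← Matrix.mulVec_transpose]
  congr 1
  ext a b
  exact hs b a

lemma IsLyapunov.isDualLyapunov (h : IsLyapunov C M) (hs : ∀ a b, M a b = M b a)
    (hr : ∀ a, ∑ b, M a b = if a = Fin.last n then 1 else 0) (hMX : M * X = 1) :
    IsDualLyapunov C X := by
  have hXM : X * M = 1 := mul_eq_one_comm.mp hMX
  rw [isLyapunov_iff] at h
  rw [isDualLyapunov_iff]
  have h1 := congrArg (fun A => X * A * X) h
  simp only [Matrix.mul_add, Matrix.add_mul, Matrix.mul_smul, Matrix.smul_mul,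
    Matrix.mul_vecMulVec, Matrix.vecMulVec_mul] at h1
  rw [← mulVec_one_of_rowSum hr, Matrix.mulVec_mulVec, hXM, Matrix.one_mulVec,
    mulVec_one_of_rowSum hr, ← one_vecMul_of_rowSum hs hr, Matrix.vecMul_vecMul, hMX,
    Matrix.vecMul_one, ← Matrix.mul_assoc, hXM, Matrix.one_mul, Matrix.one_mul] at h1
  rw [← h1, Matrix.mul_assoc X (Cᵀ * M), Matrix.mul_assoc Cᵀ, hMX, Matrix.mul_one]

lemma IsDualLyapunov.isLyapunov (h : IsDualLyapunov C X) (hs : ∀ a b, M a b = M b a)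
    (hr : ∀ a, ∑ b, M a b = if a = Fin.last n then 1 else 0) (hMX : M * X = 1) :
    IsLyapunov C M := by
  have hXM : X * M = 1 := mul_eq_one_comm.mp hMX
  rw [isDualLyapunov_iff] at h
  rw [isLyapunov_iff]
  have h1 := congrArg (fun A => M * A * M) h
  simp only [Matrix.mul_add, Matrix.add_mul, Matrix.mul_smul, Matrix.smul_mul,
    Matrix.mul_vecMulVec, Matrix.vecMulVec_mul] at h1
  rw [mulVec_one_of_rowSum hr, one_vecMul_of_rowSum hs hr, hMX, Matrix.one_mul,
    Matrix.mul_assoc M (C * X), Matrix.mul_assoc C, hXM, Matrix.mul_one,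
    ← Matrix.mul_assoc M X, hMX, Matrix.one_mul] at h1
  exact h1

end inverse

/-- The matrix of reversed partial sums of `M`. If `M` belongs to `H`, then this solves the
equation for the inverse of the certificate matrix of the H-dual of `H`. -/
def partialSums {n : ℕ} (M : Matrix (Fin (n + 1)) (Fin (n + 1)) ℝ) :
    Matrix (Fin (n + 1)) (Fin (n + 1)) ℝ :=
  Matrix.of fun a b => 1 + ∑ i : Fin (n + 1), ∑ k : Fin (n + 1),
    if (i : ℕ) + a < n ∧ (k : ℕ) + b < n then M i k else 0

/-- The sum of the last `l + 1` entries of row `r`. -/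
def tailSum {n : ℕ} (M : Matrix (Fin (n + 1)) (Fin (n + 1)) ℝ) (r l : Fin (n + 1)) : ℝ :=
  ∑ k : Fin (n + 1), if n ≤ (k : ℕ) + l then M r k else 0

lemma hDual_hDual {n : ℕ} (H : Matrix (Fin n) (Fin n) ℝ) : hDual (hDual H) = H := by
  ext a b; simp [hDual]

lemma isLowerTriangular_hDual {n : ℕ} {H : Matrix (Fin n) (Fin n) ℝ} (h : H.IsLowerTriangular) :
    (hDual H).IsLowerTriangular := fun _ _ hab => h (Fin.rev_lt_rev.mpr hab)

lemma entry_fin {n : ℕ} (H : Matrix (Fin n) (Fin n) ℝ) (a b : Fin n) :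
    entry H (a + 1) (b + 1) = H a b := by
  rw [entry, dif_pos ⟨⟨by omega, by omega⟩, ⟨by omega, by omega⟩⟩]
  rfl

section dual

variable {n : ℕ} {M : Matrix (Fin (n + 1)) (Fin (n + 1)) ℝ}

lemma partialSums_symm (hs : ∀ a b, M a b = M b a) (a b : Fin (n + 1)) :
    partialSums M a b = partialSums M b a := by
  simp only [partialSums, Matrix.of_apply]
  rw [Finset.sum_comm]
  congr 1
  refine Finset.sum_congr rfl fun i _ => Finset.sum_congr rfl fun k _ => ?_
  rw [hs]
  simp only [and_comm]

lemma partialSums_succ_sub (hs : ∀ a b, M a b = M b a)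
    (hr : ∀ a, ∑ b, M a b = if a = Fin.last n then 1 else 0) (l : Fin (n + 1)) (b : Fin n) :
    partialSums M l b.succ - partialSums M l b.castSucc = tailSum M b.rev.castSucc l := by
  have h0 := hr b.rev.castSucc
  rw [if_neg (Fin.castSucc_lt_last _).ne] at h0
  simp only [partialSums, tailSum, Matrix.of_apply]
  have e : ∑ k : Fin (n + 1), (if n ≤ (k : ℕ) + l then M b.rev.castSucc k else 0) =
      ∑ k : Fin (n + 1), ((if n ≤ (k : ℕ) + l then M b.rev.castSucc k else 0) -
        M b.rev.castSucc k) := by rw [Finset.sum_sub_distrib, h0, sub_zero]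
  rw [e, add_sub_add_left_eq_sub, ← Finset.sum_sub_distrib]
  refine Finset.sum_congr rfl fun i _ => ?_
  rw [← Finset.sum_sub_distrib, Finset.sum_eq_single b.rev.castSucc]
  · simp only [Fin.val_castSucc, Fin.val_succ, Fin.val_rev]
    have hb := b.2
    rw [if_neg (by omega), hs i]
    by_cases h : (i : ℕ) + l < n
    · rw [if_pos (by omega), if_neg (by omega)]
    · rw [if_neg (by omega), if_pos (by omega), sub_self, sub_self]
  · intro k _ hk
    have : (k : ℕ) ≠ n - (b + 1) := fun h => hk (Fin.ext (by simpa using h))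
    have hiff : (k : ℕ) + b.succ < n ↔ (k : ℕ) + b.castSucc < n := by
      simp only [Fin.val_castSucc, Fin.val_succ]; omega
    simp only [hiff, sub_self]
  · simp

lemma partialSums_zero (hs : ∀ a b, M a b = M b a)
    (hr : ∀ a, ∑ b, M a b = if a = Fin.last n then 1 else 0) (l : Fin (n + 1)) :
    partialSums M 0 l = tailSum M (Fin.last n) l := by
  have h0 := hr (Fin.last n)
  rw [if_pos rfl] at h0
  simp only [partialSums, tailSum, Matrix.of_apply]
  rw [← h0, Finset.sum_comm, ← Finset.sum_add_distrib]
  refine Finset.sum_congr rfl fun k _ => ?_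
  by_cases hk : (k : ℕ) + l < n
  · have h1 := hr k
    rw [if_neg (fun h => by rw [h, Fin.val_last] at hk; omega), Fin.sum_univ_castSucc] at h1
    rw [if_neg (by omega), Fin.sum_univ_castSucc, hs (Fin.last n)]
    simp only [hs _ k, Fin.val_castSucc, Fin.is_lt, Fin.val_last, Fin.val_zero, add_zero, hk,
      lt_irrefl, and_self, false_and, if_true, if_false]
    linarith
  · rw [if_pos (by omega)]
    simp [hk]

lemma tailSum_succ_sub (r : Fin (n + 1)) (a : Fin n) :
    tailSum M r a.succ - tailSum M r a.castSucc = M r a.rev.castSucc := by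
  simp only [tailSum]
  rw [← Finset.sum_sub_distrib, Finset.sum_eq_single a.rev.castSucc]
  · simp only [Fin.val_castSucc, Fin.val_succ, Fin.val_rev]
    have ha := a.2
    rw [if_pos (by omega), if_neg (by omega), sub_zero]
  · intro k _ hk
    have : (k : ℕ) ≠ n - (a + 1) := fun h => hk (Fin.ext (by simpa using h))
    have hiff : n ≤ (k : ℕ) + a.succ ↔ n ≤ (k : ℕ) + a.castSucc := by
      simp only [Fin.val_castSucc, Fin.val_succ]; omega
    simp only [hiff, sub_self]
  · simp

/-- Reading a column of `M C` backwards gives a row of the dual step sizes against tail sums. -/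
lemma sum_hDual_mul_tailSum (H : Matrix (Fin n) (Fin n) ℝ) (r : Fin (n + 1)) (a : Fin n) :
    ∑ l : Fin (n + 1), (if (l : ℕ) ≤ a then entry (hDual H) (a + 1) (l + 1) else 0) *
      tailSum M r l = (M * stepSum H) r a.rev.castSucc := by
  rw [Fin.sum_univ_castSucc, if_neg (by simp), zero_mul, add_zero, ← Equiv.sum_comp Fin.revPerm]
  simp only [Matrix.mul_apply, stepSum, Matrix.of_apply, Finset.mul_sum]
  rw [Finset.sum_comm]
  refine Finset.sum_congr rfl fun i _ => ?_
  simp only [Fin.revPerm_apply, Fin.val_castSucc, tailSum, Finset.mul_sum]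
  refine Finset.sum_congr rfl fun k _ => ?_
  have hi := i.2
  have ha := a.2
  rw [entry_fin, entry_fin, hDual, Matrix.of_apply, Fin.rev_rev]
  simp only [Fin.val_rev]
  by_cases h1 : n - (a + 1) ≤ (i : ℕ)
  · by_cases h2 : (i : ℕ) < k
    · rw [if_pos (by omega), if_pos (by omega), if_pos (by omega), mul_comm]
    · rw [if_neg (c := n ≤ _) (by omega), if_neg (c := _ ∧ _) (by omega)]; simp
  · rw [if_neg (by omega), if_neg (c := _ ∧ _) (by omega)]; simp

/-- The two sides of the dual equation have the same second differences, by the entries of the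
Lyapunov equation outside the last row, and the same first row, by those in the last row. -/
lemma IsLyapunov.isDualLyapunov_hDual {H : Matrix (Fin n) (Fin n) ℝ}
    (h : IsLyapunov (stepSum H) M) (hs : ∀ a b, M a b = M b a)
    (hr : ∀ a, ∑ b, M a b = if a = Fin.last n then 1 else 0) :
    IsDualLyapunov (stepSum (hDual H)) (partialSums M) := by
  set C := stepSum (hDual H) with hC
  set X := partialSums M with hX
  have hXs : ∀ a b, X a b = X b a := partialSums_symm hs
  have htr : ∀ a b, ((stepSum H)ᵀ * M) a b = (M * stepSum H) b a := by
    intro a b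
    simp only [Matrix.mul_apply, Matrix.transpose_apply]
    exact Finset.sum_congr rfl fun k _ => by rw [mul_comm, hs]
  set P := C * X with hP
  have hXC : ∀ a b, (X * Cᵀ) a b = P b a := by
    intro a b
    simp only [hP, Matrix.mul_apply, Matrix.transpose_apply]
    exact Finset.sum_congr rfl fun k _ => by rw [mul_comm, hXs]
  have hPd : ∀ (a : Fin n) b, P a.succ b - P a.castSucc b = ∑ l : Fin (n + 1),
      (if (l : ℕ) ≤ a then entry (hDual H) (a + 1) (l + 1) else 0) * X l b := by
    intro a b
    simp only [hP, hC, Matrix.mul_apply]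
    rw [← Finset.sum_sub_distrib]
    refine Finset.sum_congr rfl fun l _ => ?_
    rw [stepSum_succ]; ring
  have hPdd : ∀ a b : Fin n, (P a.succ b.succ - P a.castSucc b.succ) -
      (P a.succ b.castSucc - P a.castSucc b.castSucc) =
        (M * stepSum H) b.rev.castSucc a.rev.castSucc := by
    intro a b
    rw [hPd, hPd, ← Finset.sum_sub_distrib, ← sum_hDual_mul_tailSum]
    refine Finset.sum_congr rfl fun l _ => ?_
    rw [← mul_sub, partialSums_succ_sub hs hr]
  have hP0 : ∀ b, P 0 b = 0 := by
    intro b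
    simp only [hP, Matrix.mul_apply]
    exact Finset.sum_eq_zero fun k _ => by
      rw [hC, strictLower_stepSum _ _ _ (Fin.zero_le k), zero_mul]
  have hne : ∀ b : Fin n, b.castSucc ≠ Fin.last n := fun b => (Fin.castSucc_lt_last b).ne
  have hlast : ∀ b, (M * stepSum H) b (Fin.last n) = 0 := by
    intro b
    rw [Matrix.mul_apply]
    exact Finset.sum_eq_zero fun k _ => by
      rw [strictLower_stepSum _ _ _ (Fin.le_last k), mul_zero]
  set F : Fin (n + 1) → Fin (n + 1) → ℝ := fun a b => P a b + P b a + X a b with hF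
  have hFs : ∀ a b, F a b = F b a := fun a b => by simp only [hF, hXs a b]; ring
  have hF00 : F 0 0 = (n : ℝ) + 1 := by
    have h1 := h (Fin.last n) (Fin.last n)
    rw [htr, hlast, if_pos ⟨rfl, rfl⟩] at h1
    simp only [hF, hP0, hX, partialSums_zero hs hr, tailSum]
    rw [Finset.sum_eq_single (Fin.last n)]
    · simp only [Fin.val_last, Fin.val_zero, add_zero, le_refl, if_true]
      linarith
    · intro k _ hk
      have : (k : ℕ) < n := lt_of_le_of_ne (Nat.lt_succ_iff.mp k.2) fun h => hk (Fin.ext h)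
      exact if_neg (by simp; omega)
    · simp
  have hF0 : ∀ b : Fin n, F 0 b.succ = F 0 b.castSucc := by
    intro b
    have h1 : P b.succ 0 - P b.castSucc 0 = (M * stepSum H) (Fin.last n) b.rev.castSucc := by
      rw [hPd, ← sum_hDual_mul_tailSum]
      refine Finset.sum_congr rfl fun l _ => ?_
      rw [hXs, hX, partialSums_zero hs hr]
    have h2 : X 0 b.succ - X 0 b.castSucc = M (Fin.last n) b.rev.castSucc := by
      rw [hX, partialSums_zero hs hr, partialSums_zero hs hr, tailSum_succ_sub]
    have h3 := h (Fin.last n) b.rev.castSucc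
    rw [htr, hlast, if_neg (fun h => hne _ h.2)] at h3
    simp only [hF, hP0]
    linarith
  have hFdd : ∀ a b : Fin n, F a.succ b.succ - F a.castSucc b.succ =
      F a.succ b.castSucc - F a.castSucc b.castSucc := by
    intro a b
    have h1 := hPdd a b
    have h2 := hPdd b a
    have h3 : (X a.succ b.succ - X a.succ b.castSucc) - (X a.castSucc b.succ -
        X a.castSucc b.castSucc) = M b.rev.castSucc a.rev.castSucc := by
      rw [hX, partialSums_succ_sub hs hr, partialSums_succ_sub hs hr, tailSum_succ_sub]
    have h4 := h b.rev.castSucc a.rev.castSucc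
    rw [htr, if_neg (fun h => hne _ h.2)] at h4
    simp only [hF]
    linarith
  have hrow0 : ∀ b, F 0 b = (n : ℝ) + 1 := by
    intro b
    induction b using Fin.induction with
    | zero => exact hF00
    | succ b ih => rw [hF0, ih]
  have hstep : ∀ (a : Fin n) b, F a.succ b = F a.castSucc b := by
    intro a b
    induction b using Fin.induction with
    | zero => rw [hFs _ 0, hFs _ 0, hrow0, hrow0]
    | succ b ih => have := hFdd a b; linarith
  intro a b
  rw [hXC]
  change F a b = _
  induction a using Fin.induction with
  | zero => exact hrow0 b
  | succ a ih => rw [hstep, ih]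

end dual

/-! ### Laplacians of weighted trees -/

/-- The incidence matrix of the tree on `Fin (n + 1)` rooted at the last node in which `par v` is
the parent of `v < n`: row `v < n` is `e_v - e_{par v}`, and the last row is the last unit
vector. -/
def treeInc (n : ℕ) (par : ℕ → ℕ) : Matrix (Fin (n + 1)) (Fin (n + 1)) ℝ :=
  Matrix.of fun v b => (if b = v then 1 else 0) -
    if v ≠ Fin.last n ∧ (b : ℕ) = par v then 1 else 0

/-- The Laplacian of a tree whose arc from `v` to its parent has weight `w v`, grounded at the root
with weight `w (Fin.last n)`. -/
def treeLap {n : ℕ} (par : ℕ → ℕ) (w : Fin (n + 1) → ℝ) : Matrix (Fin (n + 1)) (Fin (n + 1)) ℝ :=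
  (treeInc n par)ᵀ * (Matrix.diagonal w * treeInc n par)

section tree

variable {n : ℕ} {par : ℕ → ℕ} {w : Fin (n + 1) → ℝ}

lemma treeLap_apply (a b : Fin (n + 1)) :
    treeLap par w a b = ∑ v, w v * (treeInc n par v a * treeInc n par v b) := by
  simp only [treeLap, Matrix.mul_apply (M := (treeInc n par)ᵀ), Matrix.diagonal_mul,
    Matrix.transpose_apply]
  exact Finset.sum_congr rfl fun v _ => by ring

lemma treeLap_symm (a b : Fin (n + 1)) : treeLap par w a b = treeLap par w b a := by
  simp only [treeLap_apply]
  exact Finset.sum_congr rfl fun v _ => by ring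

lemma treeLap_of_lt (hpar : ∀ v < n, v < par v) {a b : Fin (n + 1)} (hab : a < b) :
    treeLap par w a b = if (b : ℕ) = par a then - w a else 0 := by
  have hab' : (a : ℕ) < b := hab
  have hlt : ∀ v : Fin (n + 1), v ≠ Fin.last n → (v : ℕ) < par v := fun v hv =>
    hpar v (lt_of_le_of_ne (Nat.lt_succ_iff.mp v.2) fun h => hv (Fin.ext h))
  have ha : a ≠ Fin.last n := (lt_of_lt_of_le hab (Fin.le_last b)).ne
  have haa := hlt a ha
  rw [treeLap_apply, Finset.sum_eq_single a]
  · simp only [treeInc, Matrix.of_apply, if_true, hab.ne', if_false, ne_eq, ha, not_false_eq_true,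
      true_and, if_neg haa.ne]
    split_ifs <;> ring
  · intro v _ hva
    rcases eq_or_ne v b with rfl | hvb
    · have hz : treeInc n par v a = 0 := by
        simp only [treeInc, Matrix.of_apply]
        rw [if_neg hab.ne, if_neg, sub_zero]
        rintro ⟨h1, h2⟩
        have := hlt v h1
        omega
      rw [hz]; ring
    · simp only [treeInc, Matrix.of_apply, hva.symm, hvb.symm, if_false, zero_sub]
      by_cases h1 : v ≠ Fin.last n ∧ (a : ℕ) = par v
      · rw [if_neg (c := v ≠ Fin.last n ∧ (b : ℕ) = par v) (by omega)]; ring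
      · rw [if_neg h1]; ring
  · simp

lemma sum_treeInc (hle : ∀ v < n, par v ≤ n) (v : Fin (n + 1)) :
    ∑ b, treeInc n par v b = if v = Fin.last n then 1 else 0 := by
  simp only [treeInc, Matrix.of_apply, Finset.sum_sub_distrib, Finset.sum_ite_eq', Finset.mem_univ,
    if_true]
  by_cases hv : v = Fin.last n
  · simp [hv]
  · have h := hle v (lt_of_le_of_ne (Nat.lt_succ_iff.mp v.2) fun h => hv (Fin.ext h))
    rw [Finset.sum_eq_single ⟨par v, by omega⟩]
    · simp [hv]
    · intro b _ hb
      exact if_neg fun h => hb (Fin.ext h.2)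
    · simp

lemma sum_treeLap (hle : ∀ v < n, par v ≤ n) (hw : w (Fin.last n) = 1) (a : Fin (n + 1)) :
    ∑ b, treeLap par w a b = if a = Fin.last n then 1 else 0 := by
  simp only [treeLap_apply]
  rw [Finset.sum_comm]
  simp only [← Finset.mul_sum, sum_treeInc hle]
  rw [Finset.sum_eq_single (Fin.last n)]
  · simp [hw, treeInc]
  · intro v _ hv; simp [hv]
  · simp

lemma treeLap_nonpos (hpar : ∀ v < n, v < par v) (hw : ∀ v, 0 ≤ w v) (a b : Fin (n + 1))
    (hab : a ≠ b) : treeLap par w a b ≤ 0 := by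
  rcases lt_or_gt_of_ne hab with h | h
  · rw [treeLap_of_lt hpar h]
    split_ifs
    · linarith [hw a]
    · rfl
  · rw [treeLap_symm, treeLap_of_lt hpar h]
    split_ifs
    · linarith [hw b]
    · rfl

/-- If `F` inverts the incidence matrix, then `F W⁻¹ Fᵀ` inverts the Laplacian. -/
lemma treeLap_mul_eq_one {F : Matrix (Fin (n + 1)) (Fin (n + 1)) ℝ} (hF : treeInc n par * F = 1)
    (hw : ∀ v, w v ≠ 0) : treeLap par w * (F * (Matrix.diagonal w⁻¹ * Fᵀ)) = 1 := by
  have hF' : (treeInc n par)ᵀ * Fᵀ = 1 := by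
    rw [← Matrix.transpose_mul, mul_eq_one_comm.mp hF, Matrix.transpose_one]
  have hd : Matrix.diagonal w * Matrix.diagonal w⁻¹ = 1 := by
    rw [Matrix.diagonal_mul_diagonal, ← Matrix.diagonal_one]
    congr 1
    ext v
    simp [hw v]
  calc treeLap par w * (F * (Matrix.diagonal w⁻¹ * Fᵀ))
      = (treeInc n par)ᵀ * ((Matrix.diagonal w * (treeInc n par * F * Matrix.diagonal w⁻¹)) *
          Fᵀ) := by simp only [treeLap, Matrix.mul_assoc]
    _ = 1 := by rw [hF, Matrix.one_mul, hd, Matrix.one_mul, hF']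

lemma mul_diagonal_mul_transpose_apply (F : Matrix (Fin (n + 1)) (Fin (n + 1)) ℝ)
    (d : Fin (n + 1) → ℝ) (a b : Fin (n + 1)) :
    (F * (Matrix.diagonal d * Fᵀ)) a b = ∑ u, d u * (F a u * F b u) := by
  simp only [Matrix.mul_apply (M := F), Matrix.diagonal_mul, Matrix.transpose_apply]
  exact Finset.sum_congr rfl fun v _ => by ring

end tree

lemma ext_of_rowSum {n : ℕ} {M M' : Matrix (Fin (n + 1)) (Fin (n + 1)) ℝ}
    (hs : ∀ a b, M a b = M b a) (hs' : ∀ a b, M' a b = M' b a)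
    (hr : ∀ a, ∑ b, M a b = ∑ b, M' a b) (h : ∀ a b, a < b → M a b = M' a b) : M = M' := by
  have hne : ∀ a b, a ≠ b → M a b = M' a b := by
    intro a b hab
    rcases lt_or_gt_of_ne hab with h1 | h1
    · exact h a b h1
    · rw [hs, hs', h b a h1]
  ext a b
  rcases eq_or_ne a b with rfl | hab
  · have h1 := hr a
    rw [← Finset.add_sum_erase _ _ (Finset.mem_univ a),
      ← Finset.add_sum_erase _ (M' a) (Finset.mem_univ a),
      Finset.sum_congr rfl fun b hb => hne a b (Finset.ne_of_mem_erase hb).symm] at h1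
    linarith
  · exact hne a b hab

/-! ### The optimized Halpern algorithm -/

/-- The H-matrix of `y (k + 1) = y 0 / (k + 2) + (k + 1) / (k + 2) * T (y k)`. -/
noncomputable def halpern (n : ℕ) : Matrix (Fin n) (Fin n) ℝ :=
  Matrix.of fun a l => if l ≤ a then
    ((l : ℝ) + 1) / ((a : ℝ) + 2) - (if l < a then ((l : ℝ) + 1) / ((a : ℝ) + 1) else 0) else 0

lemma stepSum_halpern (n : ℕ) (k l : Fin (n + 1)) :
    stepSum (halpern n) k l = if l < k then ((l : ℝ) + 1) / ((k : ℝ) + 1) else 0 := by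
  induction k using Fin.induction with
  | zero => rw [strictLower_stepSum _ _ _ (Fin.zero_le l), if_neg (Fin.not_lt_zero l)]
  | succ a ih =>
    rw [stepSum_succ, ih]
    simp only [Fin.lt_def, Fin.val_succ, Fin.val_castSucc]
    rcases le_or_gt (l : ℕ) a with hla | hla
    · obtain ⟨l, rfl⟩ : ∃ l' : Fin n, l = l'.castSucc := ⟨⟨l, by omega⟩, rfl⟩
      rw [Fin.val_castSucc] at hla ⊢
      rw [if_pos (c := _ ≤ _) hla, if_pos (c := _ < (a : ℕ) + 1) (by omega),
        entry_fin, halpern, Matrix.of_apply, if_pos (show l ≤ a from hla)]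
      simp only [Fin.lt_def]
      push_cast
      split_ifs <;> ring
    · rw [if_neg (by omega), if_neg (by omega), if_neg (by omega), add_zero]

lemma isLowerTriangular_halpern (n : ℕ) : (halpern n).IsLowerTriangular := by
  intro a l hal
  exact if_neg (not_le.mpr hal)

section path

variable {n : ℕ} (A : Matrix (Fin (n + 1)) (Fin (n + 1)) ℝ)

lemma treeInc_succ_mul_castSucc (a : Fin n) (l : Fin (n + 1)) :
    (treeInc n (· + 1) * A) a.castSucc l = A a.castSucc l - A a.succ l := by
  simp only [Matrix.mul_apply, treeInc, Matrix.of_apply, sub_mul, Finset.sum_sub_distrib, ite_mul,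
    one_mul, zero_mul, Finset.sum_ite_eq', Finset.mem_univ, if_true]
  rw [Finset.sum_eq_single a.succ]
  · simp [(Fin.castSucc_lt_last a).ne]
  · intro b _ hb
    exact if_neg fun h => hb (Fin.ext h.2)
  · simp

lemma treeInc_succ_mul_last (l : Fin (n + 1)) :
    (treeInc n (· + 1) * A) (Fin.last n) l = A (Fin.last n) l := by
  simp [Matrix.mul_apply, treeInc]

lemma transpose_treeInc_succ_mul_zero (l : Fin (n + 1)) :
    ((treeInc n (· + 1))ᵀ * A) 0 l = A 0 l := by
  simp [Matrix.mul_apply, treeInc]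

lemma transpose_treeInc_succ_mul_succ (a : Fin n) (l : Fin (n + 1)) :
    ((treeInc n (· + 1))ᵀ * A) a.succ l = A a.succ l - A a.castSucc l := by
  simp only [Matrix.mul_apply, Matrix.transpose_apply, treeInc, Matrix.of_apply, sub_mul,
    Finset.sum_sub_distrib, ite_mul, one_mul, zero_mul, Finset.sum_ite_eq, Finset.mem_univ, if_true]
  rw [Finset.sum_eq_single a.castSucc]
  · simp [(Fin.castSucc_lt_last a).ne]
  · intro b _ hb
    refine if_neg fun h => hb (Fin.ext ?_)
    have := h.2
    simp only [Fin.val_succ] at this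
    simp only [Fin.val_castSucc]
    omega
  · simp

end path

/-- The weights of the certificates of the Halpern algorithm. -/
noncomputable def halpernWeight (n : ℕ) (v : Fin (n + 1)) : ℝ :=
  if v = Fin.last n then 1 else ((v : ℝ) + 1) * ((v : ℝ) + 2) / ((n : ℝ) + 1)

lemma halpernWeight_castSucc {n : ℕ} (a : Fin n) :
    halpernWeight n a.castSucc = ((a : ℝ) + 1) * ((a : ℝ) + 2) / ((n : ℝ) + 1) := by
  rw [halpernWeight, if_neg (Fin.castSucc_lt_last a).ne, Fin.val_castSucc]

lemma halpern_weighted_apply {n : ℕ} (v l : Fin (n + 1)) :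
    (Matrix.diagonal (halpernWeight n) * (treeInc n (· + 1) * stepSum (halpern n))) v l =
      if l < v then ((l : ℝ) + 1) / ((n : ℝ) + 1)
      else if l = v ∧ v ≠ Fin.last n then - ((v : ℝ) + 1) ^ 2 / ((n : ℝ) + 1) else 0 := by
  rw [Matrix.diagonal_mul]
  refine Fin.lastCases ?_ (fun a => ?_) v
  · rw [treeInc_succ_mul_last, stepSum_halpern]
    simp [halpernWeight]
  · rw [treeInc_succ_mul_castSucc, stepSum_halpern, stepSum_halpern, halpernWeight_castSucc]
    have h1 : (a : ℝ) + 1 ≠ 0 := by positivity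
    have h2 : (a : ℝ) + 2 ≠ 0 := by positivity
    have h3 : (n : ℝ) + 1 ≠ 0 := by positivity
    have h4 : (a : ℝ) + 1 + 1 ≠ 0 := by positivity
    simp only [Fin.lt_def, Fin.ext_iff, Fin.val_succ, Fin.val_castSucc, ne_eq, Fin.val_last]
    rcases lt_trichotomy (l : ℕ) a with h | h | h
    · rw [if_pos h, if_pos (by omega), if_pos h]
      push_cast
      field_simp
      ring
    · rw [if_neg (by omega), if_pos (by omega), if_neg (by omega), if_pos (by omega), h]
      push_cast
      field_simp
      ring
    · rw [if_neg (by omega), if_neg (by omega), if_neg (by omega), if_neg (by omega)]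
      ring

lemma halpern_mul_apply {n : ℕ} (i l : Fin (n + 1)) :
    (treeLap (· + 1) (halpernWeight n) * stepSum (halpern n)) i l =
      if l = i then (if i = Fin.last n then 0 else - ((i : ℝ) + 1) ^ 2 / ((n : ℝ) + 1))
      else if (l : ℕ) + 1 = i then (i : ℝ) * ((i : ℝ) + 1) / ((n : ℝ) + 1) else 0 := by
  rw [treeLap, Matrix.mul_assoc, Matrix.mul_assoc]
  refine Fin.cases ?_ (fun a => ?_) i
  · rw [transpose_treeInc_succ_mul_zero, halpern_weighted_apply, if_neg (Fin.not_lt_zero l)]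
    rcases eq_or_ne l 0 with rfl | hl
    · by_cases h : (0 : Fin (n + 1)) = Fin.last n <;> simp [h]
    · simp [hl]
  · rw [transpose_treeInc_succ_mul_succ, halpern_weighted_apply, halpern_weighted_apply]
    have ha := a.2
    simp only [Fin.lt_def, Fin.ext_iff, Fin.val_succ, Fin.val_castSucc, ne_eq, Fin.val_last]
    rcases lt_trichotomy (l : ℕ) a with h | h | h
    · rw [if_pos (by omega), if_pos h, if_neg (by omega), if_neg (by omega)]
      ring
    · rw [if_pos (by omega), if_neg (by omega), if_pos (by omega), if_neg (by omega),
        if_pos (by omega), h]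
      push_cast
      ring
    · rw [if_neg (c := (l : ℕ) < a + 1) (by omega), if_neg (c := (l : ℕ) < a) (by omega),
        if_neg (c := (l : ℕ) = a ∧ _) (by omega), sub_zero, if_neg (c := (l : ℕ) + 1 = a + 1) (by omega)]
      by_cases h1 : (l : ℕ) = a + 1 <;> by_cases h2 : (a : ℕ) + 1 = n <;> simp [h1, h2]

lemma halpern_diag {n : ℕ} (i : Fin (n + 1)) : treeLap (· + 1) (halpernWeight n) i i =
    if i = Fin.last n then (n : ℝ) + 1 else 2 * ((i : ℝ) + 1) ^ 2 / ((n : ℝ) + 1) := by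
  have h3 : (n : ℝ) + 1 ≠ 0 := by positivity
  rw [treeLap]
  have hinc : ∀ v : Fin (n + 1), treeInc n (· + 1) v v = 1 := fun v => by simp [treeInc]
  refine Fin.cases ?_ (fun a => ?_) i
  · rw [transpose_treeInc_succ_mul_zero, Matrix.diagonal_mul, hinc, halpernWeight]
    by_cases h : (0 : Fin (n + 1)) = Fin.last n
    · have : n = 0 := by have := congrArg Fin.val h; simpa using this.symm
      simp [h, this]
    · simp [h]
  · have hinc' : treeInc n (· + 1) a.castSucc a.succ = -1 := by
      simp [treeInc, (Fin.castSucc_lt_last a).ne, (Fin.castSucc_lt_succ (i := a)).ne']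
    rw [transpose_treeInc_succ_mul_succ, Matrix.diagonal_mul, Matrix.diagonal_mul, hinc, hinc',
      halpernWeight_castSucc, halpernWeight]
    simp only [Fin.ext_iff, Fin.val_succ, Fin.val_last]
    split_ifs with h
    · have hn : (n : ℝ) = a + 1 := by exact_mod_cast h.symm
      have : (a : ℝ) + 1 + 1 ≠ 0 := by positivity
      rw [hn]
      field_simp
      ring
    · push_cast
      field_simp
      ring

lemma isCertificate_halpern (n : ℕ) :
    IsCertificate (stepSum (halpern n)) (treeLap (· + 1) (halpernWeight n)) where
  symm := treeLap_symm
  rowSum := sum_treeLap (fun v hv => hv) (if_pos rfl)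
  nonpos := treeLap_nonpos (fun v _ => Nat.lt_succ_self v) fun v => by
    rw [halpernWeight]; split_ifs <;> positivity
  lyapunov := by
    have htr : ∀ a b, ((stepSum (halpern n))ᵀ * treeLap (· + 1) (halpernWeight n)) a b =
        (treeLap (· + 1) (halpernWeight n) * stepSum (halpern n)) b a := by
      intro a b
      simp only [Matrix.mul_apply, Matrix.transpose_apply]
      exact Finset.sum_congr rfl fun k _ => by rw [mul_comm, treeLap_symm]
    have hlt : ∀ a b : Fin (n + 1), a < b →
        (treeLap (· + 1) (halpernWeight n) * stepSum (halpern n)) a b +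
          (treeLap (· + 1) (halpernWeight n) * stepSum (halpern n)) b a +
          treeLap (· + 1) (halpernWeight n) a b = 0 := by
      intro a b hab
      have hab' : (a : ℕ) < b := hab
      rw [halpern_mul_apply, halpern_mul_apply, treeLap_of_lt (fun v _ => Nat.lt_succ_self v) hab,
        if_neg hab.ne', if_neg hab.ne, if_neg (by omega), halpernWeight,
        if_neg (lt_of_lt_of_le hab (Fin.le_last b)).ne]
      by_cases h : (a : ℕ) + 1 = b
      · rw [if_pos h, if_pos h.symm, ← h]
        push_cast
        ring
      · rw [if_neg h, if_neg (Ne.symm h)]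
        ring
    intro a b
    rw [htr]
    rcases lt_trichotomy a b with h | rfl | h
    · rw [hlt a b h, if_neg]
      rintro ⟨rfl, rfl⟩
      exact lt_irrefl _ h
    · rw [halpern_mul_apply, halpern_diag]
      simp only [if_true, and_self]
      split_ifs <;> ring
    · have h1 := hlt b a h
      rw [treeLap_symm b a] at h1
      rw [if_neg]
      · linarith
      · rintro ⟨rfl, rfl⟩
        exact lt_irrefl _ h

/-! ### Vertices have one nonzero certificate per node -/

/-- The index pairs `(k, j)`, `1 ≤ j < k ≤ n + 1`, whose H-certificate does not vanish. -/
def nonzeroCerts {n : ℕ} (H : Matrix (Fin n) (Fin n) ℝ) : Set (ℕ × ℕ) :=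
  {p | 1 ≤ p.2 ∧ p.2 < p.1 ∧ p.1 ≤ n + 1 ∧ cert H p.1 p.2 ≠ 0}

section vertex

variable {n : ℕ} {H : Matrix (Fin n) (Fin n) ℝ}

lemma finite_indexPairs (n : ℕ) : {p : ℕ × ℕ | 1 ≤ p.2 ∧ p.2 < p.1 ∧ p.1 ≤ n + 1}.Finite := by
  refine ((Set.finite_Iic (n + 1)).prod (Set.finite_Iic (n + 1))).subset fun p hp => ?_
  obtain ⟨_, h2, h3⟩ := hp
  exact ⟨h3, by simp only [Set.mem_Iic]; omega⟩

lemma finite_nonzeroCerts (H : Matrix (Fin n) (Fin n) ℝ) : (nonzeroCerts H).Finite :=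
  (finite_indexPairs n).subset fun _ hp => ⟨hp.1, hp.2.1, hp.2.2.1⟩

lemma ncard_zeroCerts_add (H : Matrix (Fin n) (Fin n) ℝ) :
    (zeroCerts H).ncard + (nonzeroCerts H).ncard =
      {p : ℕ × ℕ | 1 ≤ p.2 ∧ p.2 < p.1 ∧ p.1 ≤ n + 1}.ncard := by
  have hfin : (zeroCerts H).Finite :=
    (finite_indexPairs n).subset fun _ hp => ⟨hp.1, hp.2.1, hp.2.2.1⟩
  have hdis : Disjoint (zeroCerts H) (nonzeroCerts H) := by
    rw [Set.disjoint_left]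
    exact fun p hp hp' => hp'.2.2.2 hp.2.2.2
  rw [← Set.ncard_union_eq hdis hfin (finite_nonzeroCerts H)]
  congr 1
  ext p
  simp only [zeroCerts, nonzeroCerts, Set.mem_union, Set.mem_ofPred_eq]
  tauto

lemma IsOptimal.image_snd_nonzeroCerts (hH : IsOptimal H) :
    Prod.snd '' nonzeroCerts H = Set.Icc 1 n := by
  ext j
  constructor
  · rintro ⟨p, ⟨h1, h2, h3, _⟩, rfl⟩
    exact ⟨h1, by omega⟩
  · rintro ⟨h1, h2⟩
    obtain ⟨b, hab, hb⟩ := hH.exists_ne_zero hH.isCertificate ⟨j - 1, by omega⟩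
    have hc := cert_eq_neg_certMatrix H hab
    rw [certMatrix_symm] at hc
    have hab' : j - 1 < (b : ℕ) := hab
    rw [Fin.val_castSucc, Nat.sub_add_cancel h1] at hc
    refine ⟨(b + 1, j), ⟨h1, ?_, ?_, ?_⟩, rfl⟩
    · change j < (b : ℕ) + 1; omega
    · change (b : ℕ) + 1 ≤ n + 1; omega
    · change cert H (b + 1) j ≠ 0
      rw [hc]
      exact neg_ne_zero.mpr hb

lemma ncard_Icc_one (n : ℕ) : (Set.Icc 1 n).ncard = n := by
  rw [← Finset.coe_Icc, Set.ncard_coe_finset, Nat.card_Icc, Nat.add_sub_cancel]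

lemma IsOptimal.le_ncard_nonzeroCerts (hH : IsOptimal H) : n ≤ (nonzeroCerts H).ncard := by
  have h := Set.ncard_image_le (f := Prod.snd) (finite_nonzeroCerts H)
  rwa [hH.image_snd_nonzeroCerts, ncard_Icc_one] at h

lemma ncard_nonzeroCerts_le (κ : ℕ → ℕ) (h : ∀ p ∈ nonzeroCerts H, p.1 = κ p.2) :
    (nonzeroCerts H).ncard ≤ n := by
  have hsub : nonzeroCerts H ⊆ (fun j => (κ j, j)) '' Set.Icc 1 n := by
    intro p hp
    refine ⟨p.2, ⟨hp.1, ?_⟩, Prod.ext (h p hp).symm rfl⟩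
    have h1 := hp.2.1
    have h2 := hp.2.2.1
    omega
  refine (Set.ncard_le_ncard hsub ((Set.finite_Icc 1 n).image _)).trans ?_
  refine (Set.ncard_image_le (Set.finite_Icc 1 n)).trans ?_
  rw [ncard_Icc_one]

lemma IsOptimal.isVertex (hH : IsOptimal H) (h : (nonzeroCerts H).ncard ≤ n) : IsVertex H := by
  refine ⟨hH, fun H' hH' => ?_⟩
  have h1 := ncard_zeroCerts_add H
  have h2 := ncard_zeroCerts_add H'
  have h3 := hH'.le_ncard_nonzeroCerts
  omega

lemma IsCertificate.cert_eq {M : Matrix (Fin (n + 1)) (Fin (n + 1)) ℝ}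
    (hM : IsCertificate (stepSum H) M) {a b : Fin (n + 1)} (hab : b < a) :
    cert H (a + 1) (b + 1) = - M b a := by
  rw [cert_eq_neg_certMatrix H hab, hM.symm,
    (isLyapunov_certMatrix (strictLower_stepSum H)).unique (strictLower_stepSum H) hM.lyapunov]

/-- A certificate that is the Laplacian of a tree leaves one nonzero H-certificate per node. -/
lemma IsCertificate.ncard_nonzeroCerts_le {par : ℕ → ℕ} {w : Fin (n + 1) → ℝ}
    (hM : IsCertificate (stepSum H) (treeLap par w)) (hpar : ∀ v < n, v < par v) :
    (nonzeroCerts H).ncard ≤ n := by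
  refine FixedPointH.ncard_nonzeroCerts_le (fun j => par (j - 1) + 1) ?_
  rintro ⟨k, j⟩ ⟨h1, h2, h3, h4⟩
  simp only at h1 h2 h3 h4 ⊢
  obtain ⟨a, rfl⟩ : ∃ a : Fin (n + 1), k = a + 1 := ⟨⟨k - 1, by omega⟩, by simp; omega⟩
  obtain ⟨b, rfl⟩ : ∃ b : Fin (n + 1), j = b + 1 := ⟨⟨j - 1, by omega⟩, by simp; omega⟩
  have hab : b < a := by rw [Fin.lt_def]; omega
  rw [hM.cert_eq hab, treeLap_of_lt hpar hab] at h4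
  by_contra hne
  refine h4 ?_
  rw [if_neg, neg_zero]
  rw [Nat.add_sub_cancel] at hne
  omega

lemma IsVertex.ncard_nonzeroCerts_le (hH : IsVertex H) : (nonzeroCerts H).ncard ≤ n := by
  have hc := isCertificate_halpern n
  have h1 := hH.2 _ (hc.isOptimal (isLowerTriangular_halpern n))
  have h2 := hc.ncard_nonzeroCerts_le fun v _ => Nat.lt_succ_self v
  have h3 := ncard_zeroCerts_add H
  have h4 := ncard_zeroCerts_add (halpern n)
  omega

lemma IsVertex.exists_isArcDiagramOf (hH : IsVertex H) : ∃ k : ℕ → ℕ, IsArcDiagramOf k H := by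
  have himg := hH.1.image_snd_nonzeroCerts
  have hinj : Set.InjOn Prod.snd (nonzeroCerts H) := by
    refine Set.injOn_of_ncard_image_eq ?_ (finite_nonzeroCerts H)
    rw [himg, ncard_Icc_one]
    exact le_antisymm hH.1.le_ncard_nonzeroCerts hH.ncard_nonzeroCerts_le
  have hex : ∀ j, ∃ k, 1 ≤ j → j ≤ n → (k, j) ∈ nonzeroCerts H := by
    intro j
    by_cases hj : j ∈ Set.Icc 1 n
    · rw [← himg] at hj
      obtain ⟨⟨k, j'⟩, hp, rfl⟩ := hj
      exact ⟨k, fun _ _ => hp⟩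
    · exact ⟨0, fun h1 h2 => absurd ⟨h1, h2⟩ hj⟩
  choose k hk using hex
  refine ⟨k, fun j h1 h2 => ?_⟩
  obtain ⟨_, hlt, hle, hne⟩ := hk j h1 h2
  refine ⟨hlt, hle, lt_of_le_of_ne ?_ (Ne.symm hne), fun l hl1 hl2 hl3 => ?_⟩
  · simp only at hlt hle
    have hab : (⟨j - 1, by omega⟩ : Fin (n + 1)) < ⟨k j - 1, by omega⟩ := by
      rw [Fin.lt_def]; change j - 1 < k j - 1; omega
    have h := hH.1.isCertificate.cert_eq hab
    have h' := hH.1.isCertificate.nonpos _ _ hab.ne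
    rw [show (k j - 1) + 1 = k j by omega, show (j - 1) + 1 = j by omega] at h
    simp only [h]
    linarith
  · by_contra hl
    exact hl3 (congrArg Prod.fst
      (hinj (show (l, j) ∈ nonzeroCerts H from ⟨h1, hl1, hl2, hl⟩) (hk j h1 h2) rfl))

end vertex

/-! ### Paths in arc diagrams -/

section paths

variable {n : ℕ} {k : ℕ → ℕ}

lemma mem_path_iff {v j : ℕ} :
    v ∈ path n k j ↔ v = j ∨ (1 ≤ j ∧ j ≤ n ∧ v ∈ path n k (k j)) := by
  simp only [path, Set.mem_ofPred_eq]
  rw [Relation.ReflTransGen.cases_head_iff]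
  constructor
  · rintro (h | ⟨c, ⟨h1, h2, rfl⟩, hc⟩)
    · exact Or.inl h.symm
    · exact Or.inr ⟨h1, h2, hc⟩
  · rintro (h | ⟨h1, h2, hc⟩)
    · exact Or.inl h.symm
    · exact Or.inr ⟨_, ⟨h1, h2, rfl⟩, hc⟩

lemma self_mem_path (j : ℕ) : j ∈ path n k j := Relation.ReflTransGen.refl

lemma le_of_mem_path (hk : ∀ j, 1 ≤ j → j ≤ n → j < k j) {v j : ℕ} (h : v ∈ path n k j) :
    j ≤ v := by
  induction h with
  | refl => exact le_rfl
  | tail _ h ih =>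
    obtain ⟨h1, h2, rfl⟩ := h
    exact ih.trans (hk _ h1 h2).le

lemma notMem_path_of_jump (hk : ∀ j, 1 ≤ j → j ≤ n → j < k j) {v j : ℕ} (h1 : j < v)
    (h2 : v < k j) : v ∉ path n k j := by
  intro h
  rcases mem_path_iff.mp h with h | ⟨_, _, h⟩
  · omega
  · have := le_of_mem_path hk h
    omega

/-- A path from `j` to `v` passes over every node in between, either through it or above it. -/
lemma exists_arc_over {v j i : ℕ} (h : v ∈ path n k j) (hj : j ≤ i) (hi : i < v) :
    ∃ u, 1 ≤ u ∧ u ≤ n ∧ v ∈ path n k (k u) ∧ u ≤ i ∧ i < k u := by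
  simp only [path, Set.mem_ofPred_eq] at h
  induction h using Relation.ReflTransGen.head_induction_on with
  | refl => omega
  | head hs hrest ih =>
    obtain ⟨h1, h2, rfl⟩ := hs
    rename_i a
    rcases le_or_gt (k a) i with hle | hgt
    · exact ih hle
    · exact ⟨a, h1, h2, hrest, hj, hgt⟩

lemma leastDescendant_spec {v : ℕ} (h1 : 1 ≤ v) (h2 : v ≤ n + 1) :
    1 ≤ leastDescendant n k v ∧ v ∈ path n k (leastDescendant n k v) := by
  have hne : {j | 1 ≤ j ∧ j ≤ n + 1 ∧ v ∈ path n k j}.Nonempty := ⟨v, h1, h2, self_mem_path v⟩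
  have h := Nat.sInf_mem hne
  exact ⟨h.1, h.2.2⟩

lemma leastDescendant_le {v j : ℕ} (h1 : 1 ≤ j) (h2 : j ≤ n + 1) (h : v ∈ path n k j) :
    leastDescendant n k v ≤ j :=
  Nat.sInf_le ⟨h1, h2, h⟩

/-- In a non-crossing diagram the descendants of a node form an interval. -/
lemma NonCrossing.mem_path (hnc : NonCrossing n k) (hk : ∀ j, 1 ≤ j → j ≤ n → j < k j) {v : ℕ}
    (h1 : 1 ≤ v) (h2 : v ≤ n + 1) :
    ∀ j, leastDescendant n k v ≤ j → j ≤ v → v ∈ path n k j := by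
  obtain ⟨hl1, hl2⟩ := leastDescendant_spec (k := k) h1 h2
  have key : ∀ d j, v - j = d → leastDescendant n k v ≤ j → j ≤ v → v ∈ path n k j := by
    intro d
    induction d using Nat.strong_induction_on with
    | _ d ih =>
      intro j hd hlj hjv
      rcases eq_or_lt_of_le hjv with rfl | hlt
      · exact self_mem_path j
      · have hj1 : 1 ≤ j := hl1.trans hlj
        have hjn : j ≤ n := by omega
        have hjk := hk j hj1 hjn
        rcases le_or_gt (k j) v with hle | hgt
        · exact mem_path_iff.mpr (Or.inr ⟨hj1, hjn, ih (v - k j) (by omega) (k j) rfl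
            (by omega) hle⟩)
        · obtain ⟨u, hu1, hun, hvu, huj, hju⟩ := exists_arc_over hl2 hlj hlt
          have hkv := le_of_mem_path hk hvu
          have : u ≠ j := by rintro rfl; omega
          exact absurd ⟨u, j, hu1, hjn, by omega, hju, by omega⟩ hnc
  exact fun j => key _ j rfl

/-- In a non-crossing diagram, an arc other than the one leaving `p` covers the gap after `p` if
and only if it covers the gap before the least descendant of `p`. -/
lemma NonCrossing.covers_iff (hnc : NonCrossing n k)
    (hk : ∀ j, 1 ≤ j → j ≤ n → j < k j) {p q : ℕ} (hp1 : 1 ≤ p) (hpn : p ≤ n) (hq1 : 1 ≤ q)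
    (hqn : q ≤ n) (hpq : p ≠ q) :
    (q ≤ p ∧ p < k q) ↔ (q ≤ leastDescendant n k p - 1 ∧ leastDescendant n k p - 1 < k q) := by
  obtain ⟨hl1, hl2⟩ := leastDescendant_spec (k := k) hp1 (by omega : p ≤ n + 1)
  have hlp := le_of_mem_path hk hl2
  constructor
  · rintro ⟨h1, h2⟩
    have : ¬ leastDescendant n k p ≤ q := fun h =>
      notMem_path_of_jump hk (by omega) h2 (hnc.mem_path hk hp1 (by omega) q h h1)
    omega
  · rintro ⟨h1, h2⟩
    refine ⟨by omega, ?_⟩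
    by_contra hcon
    have hmem := hnc.mem_path hk hp1 (by omega) (k q) (by omega) (by omega)
    have := leastDescendant_le hq1 (by omega) (mem_path_iff.mpr (Or.inr ⟨hq1, hqn, hmem⟩))
    omega

end paths

/-! ### Arc diagrams and the H-dual -/

section arcs

variable {n : ℕ} {k : ℕ → ℕ} {H : Matrix (Fin n) (Fin n) ℝ}

lemma treeInc_mul_last {par : ℕ → ℕ} (F : Matrix (Fin (n + 1)) (Fin (n + 1)) ℝ) (u : Fin (n + 1)) :
    (treeInc n par * F) (Fin.last n) u = F (Fin.last n) u := by
  simp [Matrix.mul_apply, treeInc]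

lemma treeInc_mul_of_ne {par : ℕ → ℕ} (F : Matrix (Fin (n + 1)) (Fin (n + 1)) ℝ)
    {v c : Fin (n + 1)} (u : Fin (n + 1)) (hv : v ≠ Fin.last n) (hc : (c : ℕ) = par v) :
    (treeInc n par * F) v u = F v u - F c u := by
  simp only [Matrix.mul_apply, treeInc, Matrix.of_apply, sub_mul, Finset.sum_sub_distrib, ite_mul,
    one_mul, zero_mul, Finset.sum_ite_eq', Finset.mem_univ, if_true]
  rw [Finset.sum_eq_single c]
  · simp [hv, hc]
  · intro b _ hb
    exact if_neg fun h => hb (Fin.ext (h.2.trans hc.symm))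
  · simp

/-- The weight of the arc leaving `v`, and the grounding weight `1` at the last node. -/
noncomputable def arcWeight (k : ℕ → ℕ) (H : Matrix (Fin n) (Fin n) ℝ) (v : Fin (n + 1)) : ℝ :=
  if v = Fin.last n then 1 else cert H (k (v + 1)) (v + 1)

lemma val_lt_of_ne_last {v : Fin (n + 1)} (hv : v ≠ Fin.last n) : (v : ℕ) < n :=
  lt_of_le_of_ne (Nat.lt_succ_iff.mp v.2) fun h => hv (Fin.ext h)

lemma IsArcDiagramOf.arcWeight_pos (hk : IsArcDiagramOf k H) (v : Fin (n + 1)) :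
    0 < arcWeight k H v := by
  rw [arcWeight]
  split_ifs with h
  · exact one_pos
  · have := val_lt_of_ne_last h
    exact (hk (v + 1) (by omega) (by omega)).2.2.1

lemma IsArcDiagramOf.lt_par (hk : IsArcDiagramOf k H) : ∀ v < n, v < k (v + 1) - 1 := by
  intro v hv
  have := (hk (v + 1) (by omega) (by omega)).1
  omega

lemma IsArcDiagramOf.par_le (hk : IsArcDiagramOf k H) : ∀ v < n, k (v + 1) - 1 ≤ n := by
  intro v hv
  have := (hk (v + 1) (by omega) (by omega)).2.1
  omega

lemma IsArcDiagramOf.lt (hk : IsArcDiagramOf k H) : ∀ j, 1 ≤ j → j ≤ n → j < k j :=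
  fun j h1 h2 => (hk j h1 h2).1

lemma IsArcDiagramOf.certMatrix_eq (hk : IsArcDiagramOf k H) (hH : IsOptimal H) :
    certMatrix (stepSum H) = treeLap (fun v => k (v + 1) - 1) (arcWeight k H) := by
  have hM := hH.isCertificate
  refine ext_of_rowSum hM.symm treeLap_symm (fun a => ?_) fun a b hab => ?_
  · rw [hM.rowSum, sum_treeLap hk.par_le (if_pos rfl)]
  · have hab' : (a : ℕ) < b := hab
    have hb := b.2
    obtain ⟨h1, h2, h3, h4⟩ := hk (a + 1) (by omega) (by omega)
    have hc := hM.cert_eq hab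
    rw [treeLap_of_lt hk.lt_par hab]
    split_ifs with h
    · rw [arcWeight, if_neg (lt_of_lt_of_le hab (Fin.le_last b)).ne,
        show k (a + 1) = b + 1 by omega, hc, neg_neg]
    · rw [h4 (b + 1) (by omega) (by omega) (by omega)] at hc
      linarith

lemma partialSums_antitone {M : Matrix (Fin (n + 1)) (Fin (n + 1)) ℝ}
    (hs : ∀ a b, M a b = M b a) (hr : ∀ a, ∑ b, M a b = if a = Fin.last n then 1 else 0)
    (hM : ∀ a b, a ≠ b → M a b ≤ 0) {a b : Fin (n + 1)} (hab : a ≤ b) (c : Fin (n + 1))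
    (hbc : b ≤ c) : partialSums M a c ≤ partialSums M a b := by
  induction c using Fin.induction with
  | zero => rw [Fin.le_zero_iff.mp hbc]
  | succ c ih =>
    rcases eq_or_lt_of_le hbc with rfl | hlt
    · exact le_rfl
    · have hbc' : b ≤ c.castSucc := Fin.le_castSucc_iff.mpr hlt
      refine le_trans ?_ (ih hbc')
      have h := partialSums_succ_sub hs hr a c
      have hac : (a : ℕ) ≤ c := hab.trans hbc'
      have : tailSum M c.rev.castSucc a ≤ 0 := by
        refine Finset.sum_nonpos fun k _ => ?_
        split_ifs with hk
        · refine hM _ _ fun h => ?_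
          have := congrArg Fin.val h
          simp only [Fin.val_castSucc, Fin.val_rev] at this
          have := c.2
          omega
        · exact le_rfl
      linarith

open Classical in
/-- The `0`-`1` matrix of the relation that `u` lies on the path from `b` to the root. -/
noncomputable def pathMatrix (n : ℕ) (k : ℕ → ℕ) : Matrix (Fin (n + 1)) (Fin (n + 1)) ℝ :=
  Matrix.of fun b u => if (u : ℕ) + 1 ∈ path n k (b + 1) then 1 else 0

lemma IsArcDiagramOf.treeInc_mul_pathMatrix (hk : IsArcDiagramOf k H) :
    treeInc n (fun v => k (v + 1) - 1) * pathMatrix n k = 1 := by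
  ext v u
  rw [Matrix.one_apply]
  by_cases hv : v = Fin.last n
  · subst hv
    rw [treeInc_mul_last, pathMatrix, Matrix.of_apply]
    have : (u : ℕ) + 1 ∈ path n k ((Fin.last n : ℕ) + 1) ↔ Fin.last n = u := by
      rw [mem_path_iff, Fin.val_last, Fin.ext_iff, Fin.val_last]
      omega
    simp only [this]
  · have hvn := val_lt_of_ne_last hv
    obtain ⟨h1, h2, _⟩ := hk (v + 1) (by omega) (by omega)
    rw [treeInc_mul_of_ne (c := ⟨k (v + 1) - 1, by omega⟩) _ _ hv rfl]
    simp only [pathMatrix, Matrix.of_apply]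
    rw [show k (v + 1) - 1 + 1 = k (v + 1) by omega]
    rcases eq_or_ne v u with rfl | hvu
    · rw [if_pos (self_mem_path _), if_neg (fun h => by have := le_of_mem_path hk.lt h; omega)]
      simp
    · have hne : (u : ℕ) + 1 ≠ v + 1 := fun h => hvu (Fin.ext (by omega))
      have : (u : ℕ) + 1 ∈ path n k (v + 1) ↔ (u : ℕ) + 1 ∈ path n k (k (v + 1)) := by
        rw [mem_path_iff]
        constructor
        · rintro (h | h)
          · exact absurd h hne
          · exact h.2.2
        · exact fun h => Or.inr ⟨by omega, by omega, h⟩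
      rw [if_neg hvu]
      by_cases h : (u : ℕ) + 1 ∈ path n k (k (v + 1))
      · rw [if_pos (this.mpr h), if_pos h, sub_self]
      · rw [if_neg (fun h' => h (this.mp h')), if_neg h, sub_self]

/-- If the H-dual is optimal, then the inverse `X` of the certificate matrix of `H` decreases along
its rows to the right of the diagonal. For a tree, `X a b` sums inverse weights over the common part
of the paths of `a` and `b`, which grows from `b = j₂` to `b = k j₁` at a crossing of the arcs of
`a = j₁` and `j₂`. -/
theorem IsArcDiagramOf.nonCrossing (hk : IsArcDiagramOf k H) (hH : IsOptimal H)
    (hD : IsOptimal (hDual H)) : NonCrossing n k := by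
  rintro ⟨j₁, j₂, h1, h2, h12, h3, h4⟩
  set F := pathMatrix n k with hF
  set w := arcWeight k H with hw
  set X := F * (Matrix.diagonal w⁻¹ * Fᵀ) with hX
  have hM := hH.isCertificate
  have hD' := hD.isCertificate
  have hX1 : IsDualLyapunov (stepSum H) X := by
    refine hM.lyapunov.isDualLyapunov hM.symm hM.rowSum ?_
    rw [hk.certMatrix_eq hH]
    exact treeLap_mul_eq_one hk.treeInc_mul_pathMatrix fun v => (hk.arcWeight_pos v).ne'
  have hX2 := hD'.lyapunov.isDualLyapunov_hDual hD'.symm hD'.rowSum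
  rw [hDual_hDual] at hX2
  have hXe := hX1.unique (strictLower_stepSum H) hX2
  have hk1 := hk j₁ h1 (by omega)
  have hle := hk1.2.1
  set a : Fin (n + 1) := ⟨j₁ - 1, by omega⟩ with ha
  set b : Fin (n + 1) := ⟨j₂ - 1, by omega⟩ with hb
  set c : Fin (n + 1) := ⟨k j₁ - 1, by omega⟩ with hc
  have hav : (a : ℕ) + 1 = j₁ := by change j₁ - 1 + 1 = j₁; omega
  have hbv : (b : ℕ) + 1 = j₂ := by change j₂ - 1 + 1 = j₂; omega
  have hcv : (c : ℕ) + 1 = k j₁ := by change k j₁ - 1 + 1 = k j₁; omega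
  have hmono : X a c ≤ X a b := by
    rw [hXe]
    refine partialSums_antitone hD'.symm hD'.rowSum hD'.nonpos ?_ c ?_ <;> rw [Fin.le_def] <;> omega
  -- A common node of the paths of `j₁` and `j₂` lies on the path of `k j₁`, and `k j₁` itself lies on
  -- the path of `j₁` but not on that of `j₂`.
  refine absurd hmono (not_le.mpr ?_)
  rw [hX, mul_diagonal_mul_transpose_apply, mul_diagonal_mul_transpose_apply]
  have hwinv : ∀ u, 0 < w⁻¹ u := fun u => inv_pos.mpr (hk.arcWeight_pos u)
  have hbc : (c : ℕ) + 1 ∉ path n k (b + 1) := by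
    rw [hcv, hbv]
    exact notMem_path_of_jump hk.lt h3 h4
  have hac : (c : ℕ) + 1 ∈ path n k (a + 1) := by
    rw [hcv, hav]
    exact mem_path_iff.mpr (Or.inr ⟨h1, by omega, self_mem_path _⟩)
  refine Finset.sum_lt_sum (fun u _ => ?_) ⟨c, Finset.mem_univ c, ?_⟩
  · refine mul_le_mul_of_nonneg_left ?_ (hwinv u).le
    simp only [hF, pathMatrix, Matrix.of_apply]
    by_cases hua : (u : ℕ) + 1 ∈ path n k (a + 1)
    · by_cases hub : (u : ℕ) + 1 ∈ path n k (b + 1)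
      · have huc : (u : ℕ) + 1 ∈ path n k (c + 1) := by
          have hbu := le_of_mem_path hk.lt hub
          rcases mem_path_iff.mp hua with h | ⟨_, _, h⟩
          · omega
          · rwa [hav, ← hcv] at h
        rw [if_pos hua, if_pos hub, if_pos huc]
      · rw [if_pos hua, if_neg hub]
        split_ifs <;> norm_num
    · rw [if_neg hua]
      simp
  · refine mul_lt_mul_of_pos_left ?_ (hwinv c)
    simp only [hF, pathMatrix, Matrix.of_apply]
    rw [if_pos hac, if_neg hbc, if_pos (self_mem_path _)]
    norm_num

/-- The parent map of the dual tree. Node `a` stands for the gap after node `n - a` of the diagram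
(before node `1`, if `a = n`), and its parent for the gap before the least descendant of that node. -/
noncomputable def dualPar (n : ℕ) (k : ℕ → ℕ) (a : ℕ) : ℕ := n + 1 - leastDescendant n k (n - a)

/-- The weights of the dual tree: the inverse weights of the arcs. -/
noncomputable def dualWeight (k : ℕ → ℕ) (H : Matrix (Fin n) (Fin n) ℝ) (a : Fin (n + 1)) : ℝ :=
  if a = Fin.last n then 1 else 1 / cert H (k (n - a)) (n - a)

/-- The `0`-`1` matrix of the relation that the arc leaving node `n - u` covers the gap after node
`n - a`. The last column belongs to the ground, which covers everything. -/
def coverMatrix (n : ℕ) (k : ℕ → ℕ) : Matrix (Fin (n + 1)) (Fin (n + 1)) ℝ :=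
  Matrix.of fun a u =>
    if u = Fin.last n ∨ (n - (u : ℕ) ≤ n - a ∧ n - a < k (n - u)) then 1 else 0

lemma leastDescendant_bounds (hk : IsArcDiagramOf k H) {a : ℕ} (ha : a < n) :
    1 ≤ leastDescendant n k (n - a) ∧ leastDescendant n k (n - a) ≤ n - a := by
  obtain ⟨h1, h2⟩ := leastDescendant_spec (n := n) (k := k) (v := n - a) (by omega) (by omega)
  exact ⟨h1, le_of_mem_path hk.lt h2⟩

lemma IsArcDiagramOf.lt_dualPar (hk : IsArcDiagramOf k H) : ∀ v < n, v < dualPar n k v := by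
  intro v hv
  have := leastDescendant_bounds hk hv
  rw [dualPar]
  omega

lemma IsArcDiagramOf.dualPar_le (hk : IsArcDiagramOf k H) : ∀ v < n, dualPar n k v ≤ n := by
  intro v hv
  have := leastDescendant_bounds hk hv
  rw [dualPar]
  omega

lemma IsArcDiagramOf.dualWeight_pos (hk : IsArcDiagramOf k H) (v : Fin (n + 1)) :
    0 < dualWeight k H v := by
  rw [dualWeight]
  split_ifs with h
  · exact one_pos
  · have := val_lt_of_ne_last h
    exact one_div_pos.mpr (hk (n - v) (by omega) (by omega)).2.2.1

lemma IsArcDiagramOf.treeInc_mul_coverMatrix (hk : IsArcDiagramOf k H) (hnc : NonCrossing n k) :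
    treeInc n (dualPar n k) * coverMatrix n k = 1 := by
  ext v u
  rw [Matrix.one_apply]
  by_cases hv : v = Fin.last n
  · subst hv
    rw [treeInc_mul_last, coverMatrix, Matrix.of_apply]
    by_cases hu : u = Fin.last n
    · simp [hu]
    · have := val_lt_of_ne_last hu
      rw [if_neg, if_neg (Ne.symm hu)]
      rw [Fin.val_last]
      rintro (h | h)
      · exact hu h
      · omega
  · have hvn := val_lt_of_ne_last hv
    have hb := leastDescendant_bounds hk hvn
    rw [treeInc_mul_of_ne (c := ⟨dualPar n k v, by have := hk.dualPar_le v hvn; omega⟩) _ _ hv rfl]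
    simp only [coverMatrix, Matrix.of_apply]
    by_cases hu : u = Fin.last n
    · simp [hu, hv]
    · have hun := val_lt_of_ne_last hu
      have hc : n - dualPar n k v = leastDescendant n k (n - v) - 1 := by rw [dualPar]; omega
      simp only [hu, false_or, hc]
      rcases eq_or_ne v u with rfl | hvu
      · have h1 := hk.lt (n - v) (by omega) (by omega)
        rw [if_pos ⟨le_rfl, h1⟩, if_neg (by omega)]
        simp
      · have hne : n - (v : ℕ) ≠ n - u := fun h => hvu (Fin.ext (by omega))
        rw [if_neg hvu]
        simp only [hnc.covers_iff hk.lt (by omega) (by omega) (by omega) (by omega) hne, sub_self]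

/-- The partial sums of the Laplacian of the arc diagram count, with weights, the arcs covering
both gaps. -/
lemma IsArcDiagramOf.partialSums_treeLap (hk : IsArcDiagramOf k H) :
    partialSums (treeLap (fun v => k (v + 1) - 1) (arcWeight k H)) =
      coverMatrix n k * (Matrix.diagonal (dualWeight k H)⁻¹ * (coverMatrix n k)ᵀ) := by
  ext a b
  set S : Fin (n + 1) → Fin (n + 1) → ℝ := fun v a =>
    ∑ i : Fin (n + 1), if (i : ℕ) + a < n then treeInc n (fun v => k (v + 1) - 1) v i else 0 with hS
  have hlast : ∀ a, S (Fin.last n) a = 0 := by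
    intro a
    refine Finset.sum_eq_zero fun i _ => ?_
    split_ifs with h
    · simp only [treeInc, Matrix.of_apply]
      rw [if_neg (fun hi => by rw [hi, Fin.val_last] at h; omega)]
      simp
    · rfl
  have hcast : ∀ (x : Fin n) a, S x.rev.castSucc a = coverMatrix n k a x.castSucc := by
    intro x a
    have hx := x.2
    obtain ⟨h1, h2, _⟩ := hk (n - x) (by omega) (by omega)
    have hval : ((x.rev.castSucc : Fin (n + 1)) : ℕ) + 1 = n - x := by
      simp only [Fin.val_castSucc, Fin.val_rev]; omega
    simp only [hS, treeInc, Matrix.of_apply, coverMatrix]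
    simp only [hval]
    have e : ∀ i : Fin (n + 1), (if (i : ℕ) + a < n then ((if i = x.rev.castSucc then (1 : ℝ) else 0) -
        if x.rev.castSucc ≠ Fin.last n ∧ (i : ℕ) = k (n - x) - 1 then 1 else 0) else 0) =
        (if i = x.rev.castSucc then (if n - x ≤ n - (a : ℕ) then 1 else 0) else 0) -
        (if i = (⟨k (n - x) - 1, by omega⟩ : Fin (n + 1)) then
          (if k (n - x) ≤ n - (a : ℕ) then 1 else 0) else 0) := by
      intro i
      simp only [ne_eq, (Fin.castSucc_lt_last x.rev).ne, not_false_eq_true, true_and, Fin.ext_iff,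
        Fin.val_castSucc, Fin.val_rev]
      split_ifs <;> first | omega | simp
    rw [Finset.sum_congr rfl fun i _ => e i, Finset.sum_sub_distrib]
    simp only [Finset.sum_ite_eq', Finset.mem_univ, if_true, (Fin.castSucc_lt_last x).ne, false_or,
      Fin.val_castSucc]
    split_ifs <;> first | omega | simp
  have hsum : partialSums (treeLap (fun v => k (v + 1) - 1) (arcWeight k H)) a b =
      1 + ∑ v, arcWeight k H v * (S v a * S v b) := by
    simp only [partialSums, Matrix.of_apply, treeLap_apply, hS, Finset.sum_mul_sum]
    simp only [Finset.mul_sum]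
    congr 1
    symm
    rw [Finset.sum_comm]
    refine Finset.sum_congr rfl fun i _ => ?_
    rw [Finset.sum_comm]
    refine Finset.sum_congr rfl fun j _ => ?_
    by_cases h1 : (i : ℕ) + a < n
    · by_cases h2 : (j : ℕ) + b < n <;> simp [h1, h2]
    · simp [h1]
  rw [hsum, mul_diagonal_mul_transpose_apply, Fin.sum_univ_castSucc, hlast, zero_mul, mul_zero,
    add_zero, Fin.sum_univ_castSucc (f := fun u => (dualWeight k H)⁻¹ u *
      (coverMatrix n k a u * coverMatrix n k b u)), add_comm, ← Equiv.sum_comp Fin.revPerm]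
  congr 1
  · refine Finset.sum_congr rfl fun x _ => ?_
    have hx := x.2
    rw [Fin.revPerm_apply, hcast, hcast]
    congr 1
    rw [Pi.inv_apply, arcWeight, dualWeight, if_neg (Fin.castSucc_lt_last _).ne,
      if_neg (Fin.castSucc_lt_last _).ne, Fin.val_castSucc, Fin.val_castSucc, Fin.val_rev,
      show n - ((x : ℕ) + 1) + 1 = n - x by omega, one_div, inv_inv]
  · simp [dualWeight, coverMatrix]

theorem IsArcDiagramOf.isCertificate_hDual (hk : IsArcDiagramOf k H) (hH : IsOptimal H)
    (hnc : NonCrossing n k) :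
    IsCertificate (stepSum (hDual H)) (treeLap (dualPar n k) (dualWeight k H)) where
  symm := treeLap_symm
  rowSum := sum_treeLap hk.dualPar_le (if_pos rfl)
  nonpos := treeLap_nonpos hk.lt_dualPar fun v => (hk.dualWeight_pos v).le
  lyapunov := by
    have hM := hH.isCertificate
    have hX := hM.lyapunov.isDualLyapunov_hDual hM.symm hM.rowSum
    rw [hk.certMatrix_eq hH, hk.partialSums_treeLap] at hX
    exact hX.isLyapunov treeLap_symm (sum_treeLap hk.dualPar_le (if_pos rfl))
      (treeLap_mul_eq_one (hk.treeInc_mul_coverMatrix hnc) fun v => (hk.dualWeight_pos v).ne')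

lemma IsArcDiagramOf.cert_hDual (hk : IsArcDiagramOf k H) (hH : IsOptimal H)
    (hnc : NonCrossing n k) {i j : ℕ} (hj : 1 ≤ j) (hji : j < i) (hi : i ≤ n + 1) :
    cert (hDual H) ((n + 1) - j + 1) ((n + 1) - i + 1) =
      if j = leastDescendant n k (i - 1) then 1 / cert H (k (i - 1)) (i - 1) else 0 := by
  set a : Fin (n + 1) := ⟨n + 1 - j, by omega⟩ with ha
  set b : Fin (n + 1) := ⟨n + 1 - i, by omega⟩ with hb
  have hab : b < a := by
    rw [Fin.lt_def]; change n + 1 - i < n + 1 - j; omega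
  have h := (hk.isCertificate_hDual hH hnc).cert_eq hab
  rw [treeLap_of_lt hk.lt_dualPar hab, dualWeight,
    if_neg (lt_of_lt_of_le hab (Fin.le_last a)).ne] at h
  have hnb : n - (b : ℕ) = i - 1 := by change n - (n + 1 - i) = i - 1; omega
  have hl := leastDescendant_bounds hk (a := (b : ℕ)) (by change n + 1 - i < n; omega)
  rw [dualPar, hnb] at h
  rw [hnb] at hl
  change cert (hDual H) (a + 1) (b + 1) = _
  rw [h]
  have hav : (a : ℕ) = n + 1 - j := rfl
  by_cases hjl : j = leastDescendant n k (i - 1)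
  · rw [if_pos hjl, if_pos (by omega), neg_neg]
  · rw [if_neg hjl, if_neg (by omega), neg_zero]

end arcs

end FixedPointH

open FixedPointH
theorem mainTheorem2 (n : ℕ) (H : Matrix (Fin n) (Fin n) ℝ) (hH : IsVertex H) :
    ∃ k : ℕ → ℕ, IsArcDiagramOf k H ∧
      (IsOptimal (hDual H) ↔ NonCrossing n k) ∧
      (NonCrossing n k →
        IsVertex (hDual H) ∧
        ∀ i j : ℕ, 1 ≤ j → j < i → i ≤ n + 1 →
          cert (hDual H) ((n + 1) - j + 1) ((n + 1) - i + 1) =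
            if j = leastDescendant n k (i - 1) then 1 / cert H (k (i - 1)) (i - 1) else 0) := by
  obtain ⟨k, hk⟩ := hH.exists_isArcDiagramOf
  have hopt : NonCrossing n k → IsOptimal (hDual H) := fun hnc =>
    (hk.isCertificate_hDual hH.1 hnc).isOptimal (isLowerTriangular_hDual hH.1.1)
  refine ⟨k, hk, ⟨hk.nonCrossing hH.1, hopt⟩, fun hnc => ⟨?_, fun i j hj hji hi => ?_⟩⟩
  · exact (hopt hnc).isVertex
      ((hk.isCertificate_hDual hH.1 hnc).ncard_nonzeroCerts_le hk.lt_dualPar)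
  · exact hk.cert_hDual hH.1 hnc hj hji hi
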